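/- Let $N\ge 1$, $Q=(0,1)^N$, $s\in(0,1)$ and $p\in[1,\infty]$. For $w:(0,1)\to\mathbb R$ let $$d_R^s w(x)=-\frac1{\Gamma(1-s)}\frac{d}{dx}\int_x^1\frac{w(t)}{(t-x)^s}\,dt$$ be the right-sided Riemann–Liouville derivative, let $\partial^s_{i,R}$ be the same operation in the variable $x_i$, and for $\varphi\in C_c^\infty(Q;\mathbb R^N)$ put $$\operatorname{div}^s\varphi=\Big[\big(1-\tfrac1N\big)s+\tfrac1N\Big]\sum_{i=1}^N\partial^s_{i,R}\varphi_i .$$ For $q\in[1,\infty]$ and $u\in L^1(Q)$ define $$TV^s_{\ell^q}(u)=\sup\Big\{\int_Q u\,\operatorname{div}^s\varphi\,dx:\ \varphi\in C_c^\infty(Q;\mathbb R^N),\ |\varphi|^*_{\ell^q}\le 1\Big\},$$ where $|\cdot|^*_{\ell^q}$ is the dual norm of the $\ell^q$ norm on $\mathbb R^N$. Let $BV^s(Q)$ be the set of $u\in L^1(Q)$ with $TV^s_{\ell^q}(u)<\infty$ for all $q\in[1,\infty]$, and let $\|u\|_{BV^s(Q)}=\|u\|_{L^1(Q)}+TV^s_{\ell^p}(u)$.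 Let $SV^s(Q)$ be the set of $u\in L^1(Q)$ such that for every $q\in[1,\infty]$ we have $TV^s_{\ell^q}(u)<\infty$ and there are $v_m\in C^\infty(Q)\cap L^1(Q)$ with $TV^s_{\ell^q}(v_m)<\infty$, $v_m\to u$ in $L^1(Q)$ and $TV^s_{\ell^q}(v_m)\to TV^s_{\ell^q}(u)$. Let $BV(Q)$ be the classical space of functions of bounded variation; for $u\in BV(Q)$ let $\|u\|_{L^\infty(\partial Q)}$ be the $L^\infty(\partial Q,\mathcal H^{N-1})$ norm of its boundary trace $T[u]$, which is characterized by $\lim_{\varepsilon\to0}\frac{1}{|B(x_0,\varepsilon)\cap Q|}\int_{B(x_0,\varepsilon)\cap Q}|u-T[u](x_0)|\,dx=0$ for $\mathcal H^{N-1}$-a.e. $x_0\in\partial Q$. **Theorem.** Let $(u_n)_{n\in\mathbb N}\subset SV^s(Q)\cap BV(Q)$ satisfy $$\sup_{n\in\mathbb N}\big(\|u_n\|_{L^\infty(\partial Q)}+\|u_n\|_{BV^s(Q)}\big)<\infty .$$ Then there exist $u\in BV^s(Q)$ and a subsequence of $(u_n)$ that converges to $u$ strongly in $L^1(Q)$.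 -/

import Mathlib

open MeasureTheory Filter Topology Set
open scoped ENNReal ContDiff

noncomputable section

namespace FracBV

/-- The open unit cube `Q = (0,1)^N`. -/
def cube (N : ℕ) : Set (Fin N → ℝ) :=
  Set.pi Set.univ fun _ => Set.Ioo (0 : ℝ) 1

/-- The right-sided Riemann–Liouville derivative of order `s ∈ (0,1)` on `(0,1)`:
`d_R^s w (x) = - 1/Γ(1-s) · d/dx ∫_x^1 w(t) (t-x)^{-s} dt`. -/
def rlDerivRight (s : ℝ) (w : ℝ → ℝ) (x : ℝ) : ℝ :=
  -(1 / Real.Gamma (1 - s)) * deriv (fun y => ∫ t in y..1, w t / (t - y) ^ s) x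

/-- The right-sided fractional partial derivative `∂_{i,R}^s f`. -/
def rlPartialRight {N : ℕ} (s : ℝ) (i : Fin N) (f : (Fin N → ℝ) → ℝ) (x : Fin N → ℝ) : ℝ :=
  rlDerivRight s (fun t => f (Function.update x i t)) (x i)

/-- The (scaled) fractional divergence of order `s`. -/
def fracDiv {N : ℕ} (s : ℝ) (φ : (Fin N → ℝ) → (Fin N → ℝ)) (x : Fin N → ℝ) : ℝ :=
  ((1 - 1 / (N : ℝ)) * s + 1 / (N : ℝ)) * ∑ i, rlPartialRight s i (fun y => φ y i) x

/-- The classical divergence. -/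
def classicalDiv {N : ℕ} (φ : (Fin N → ℝ) → (Fin N → ℝ)) (x : Fin N → ℝ) : ℝ :=
  ∑ i, deriv (fun t => φ (Function.update x i t) i) (x i)

/-- The dual norm of the `ℓ^p` norm on `ℝ^N`. -/
def dualNorm {N : ℕ} (p : ℝ≥0∞) (y : Fin N → ℝ) : ℝ :=
  sSup {t : ℝ | ∃ x : Fin N → ℝ, ‖WithLp.toLp p x‖ ≤ 1 ∧ t = ∑ i, x i * y i}

/-- Admissible test fields: `φ ∈ C_c^∞(Q; ℝ^N)` with `|φ|_{ℓ^p}^* ≤ 1`. -/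
structure IsTestField {N : ℕ} (p : ℝ≥0∞) (φ : (Fin N → ℝ) → (Fin N → ℝ)) : Prop where
  smooth : ContDiff ℝ ∞ φ
  compactSupport : HasCompactSupport φ
  support_subset : tsupport φ ⊆ cube N
  dualNorm_le : ∀ x, dualNorm p (φ x) ≤ 1

/-- `sup { ∫_Q u D(φ) dx : φ ∈ C_c^∞(Q; ℝ^N), |φ|_{ℓ^p}^* ≤ 1 } ∈ [0,∞]`. The truncation by
`ENNReal.ofReal` does not change the supremum, as `φ = 0` is admissible. -/
def variation {N : ℕ} (D : ((Fin N → ℝ) → (Fin N → ℝ)) → (Fin N → ℝ) → ℝ)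
    (p : ℝ≥0∞) (u : (Fin N → ℝ) → ℝ) : ℝ≥0∞ :=
  ⨆ (φ : (Fin N → ℝ) → (Fin N → ℝ)) (_ : IsTestField p φ),
    ENNReal.ofReal (∫ x in cube N, u x * D φ x)

/-- The first order total variation `TV_{ℓ^p}`. -/
def TV {N : ℕ} (p : ℝ≥0∞) (u : (Fin N → ℝ) → ℝ) : ℝ≥0∞ :=
  variation classicalDiv p u

/-- The fractional total variation `TV^s_{ℓ^p}`, `s ∈ (0,1)`. -/
def fracTV {N : ℕ} (s : ℝ) (p : ℝ≥0∞) (u : (Fin N → ℝ) → ℝ) : ℝ≥0∞ :=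
  variation (fracDiv s) p u

/-- The `L^1(Q)` norm. -/
def normL1 {N : ℕ} (u : (Fin N → ℝ) → ℝ) : ℝ≥0∞ :=
  eLpNorm u 1 (volume.restrict (cube N))

/-- `u ∈ BV(Q)`. -/
def MemBV {N : ℕ} (u : (Fin N → ℝ) → ℝ) : Prop :=
  IntegrableOn u (cube N) ∧ TV 2 u < ⊤

/-- `u ∈ BV^s(Q)`. -/
def MemFracBV {N : ℕ} (s : ℝ) (u : (Fin N → ℝ) → ℝ) : Prop :=
  IntegrableOn u (cube N) ∧ ∀ p : ℝ≥0∞, 1 ≤ p → fracTV s p u < ⊤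

/-- `‖u‖_{BV^s(Q)} = ‖u‖_{L^1(Q)} + TV^s_{ℓ^p}(u)`. -/
def fracBVNorm {N : ℕ} (s : ℝ) (p : ℝ≥0∞) (u : (Fin N → ℝ) → ℝ) : ℝ≥0∞ :=
  normL1 u + fracTV s p u

/-- Strict convergence `v n → u` with respect to `TV^s_{ℓ^p}`. All total variations are finite,
so convergence in `[0,∞]` is convergence of real numbers. -/
structure StrictConv {N : ℕ} (s : ℝ) (p : ℝ≥0∞)
    (v : ℕ → (Fin N → ℝ) → ℝ) (u : (Fin N → ℝ) → ℝ) : Prop where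
  integrable : ∀ n, IntegrableOn (v n) (cube N)
  integrable_lim : IntegrableOn u (cube N)
  finite : ∀ n, fracTV s p (v n) < ⊤
  finite_lim : fracTV s p u < ⊤
  tendsto_L1 : Tendsto (fun n => normL1 (fun x => v n x - u x)) atTop (𝓝 0)
  tendsto_TV : Tendsto (fun n => fracTV s p (v n)) atTop (𝓝 (fracTV s p u))

/-- `u ∈ SV^s(Q)`: for every `p ∈ [1,∞]`, `u` is the strict `TV^s_{ℓ^p}` limit of functions
in `C^∞(Q)`. -/
def MemSV {N : ℕ} (s : ℝ) (u : (Fin N → ℝ) → ℝ) : Prop :=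
  ∀ p : ℝ≥0∞, 1 ≤ p → ∃ v : ℕ → (Fin N → ℝ) → ℝ,
    (∀ n, ContDiffOn ℝ ∞ (v n) (cube N)) ∧ StrictConv s p v u

/-- The surface measure on `∂Q`: the `(N-1)`-dimensional Hausdorff measure of the Euclidean
distance. -/
def surfaceMeasure (N : ℕ) : Measure (Fin N → ℝ) :=
  (Measure.map (fun x : EuclideanSpace ℝ (Fin N) => x.ofLp)
    (Measure.hausdorffMeasure ((N : ℝ) - 1))).restrict (frontier (cube N))

/-- `B(x, ε) ∩ Q` with the Euclidean ball `B(x, ε)`. -/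
def ballInCube {N : ℕ} (x : Fin N → ℝ) (ε : ℝ) : Set (Fin N → ℝ) :=
  {y | ‖WithLp.toLp 2 y - WithLp.toLp 2 x‖ < ε} ∩ cube N

/-- `g` is the boundary trace `T[u]` of `u`: for almost every `x₀ ∈ ∂Q`, the averages of
`|u - g(x₀)|` over `B(x₀, ε) ∩ Q` tend to `0` as `ε → 0`. -/
def IsTrace {N : ℕ} (u g : (Fin N → ℝ) → ℝ) : Prop :=
  ∀ᵐ x₀ ∂(surfaceMeasure N),
    Tendsto (fun ε : ℝ => ⨍ y in ballInCube x₀ ε, |u y - g x₀|) (𝓝[>] 0) (𝓝 0)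

/-- `‖u‖_{L^∞(∂Q)}`, the essential supremum on `∂Q` of the modulus of the trace of `u`.
A trace is unique almost everywhere on `∂Q`, so the infimum is over a single value if `u` has a
trace, as every `u ∈ BV(Q)` does. -/
def boundaryNorm {N : ℕ} (u : (Fin N → ℝ) → ℝ) : ℝ≥0∞ :=
  ⨅ (g : (Fin N → ℝ) → ℝ) (_ : IsTrace u g), eLpNormEssSup g (surfaceMeasure N)

end FracBV

end

/-!
For a test function `f` on `Q`, correct the right-sided fractional integral `I_i^s f` in `x_i`, with
kernel `r^(s-1)` (no factor `1 / Γ(s)`), so that it vanishes on `x_i = 0`, and cut it off at scale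
`ε` to obtain an admissible test function `w`. By Abel's identity
`I^(1-s) I^s ∂_i f = -B(1-s, s) f`, the derivative `∂^s_{i,R} w` is a multiple of `f` up to an error
`≤ C ‖I_i^s f‖_∞ + o(1)` as `ε → 0`. Hence `|∫_Q u f| ≤ A ‖I_i^s f‖_∞ ‖u‖_{BV^s}`.

Apply this to `f = ψ(· - h e_i) - ψ` with `|ψ| ≤ 1`: here `‖I_i^s f‖_∞` is at most the `L¹` modulus
of continuity at `h` of the kernel `r^(s-1)`, which tends to `0` with `h`. By duality, bounded
sets of `BV^s` are equicontinuous under translations in `L¹`. Averaging over the cells of a grid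
gives total boundedness in `L¹(Q)` (Fréchet–Kolmogorov), and the lower semicontinuity of `TV^s`,
together with the comparability of its variants for different `ℓ^q`, puts the limit in `BV^s(Q)`.
-/

noncomputable section

namespace FracBV

/-! ### Fractional integrals on the line -/

/-- The truncated Riemann–Liouville kernel `r ↦ r^(a-1)` on `(0,1]`, extended by zero. The factor
`1 / Γ(a)` is left out. -/
def fracKernel (a : ℝ) : ℝ → ℝ :=
  (Ioc (0 : ℝ) 1).indicator fun r => r ^ (a - 1)

/-- The truncated, unnormalized right-sided fractional integral of order `a`. For functions
vanishing on `[1,∞)` it agrees on `[0,1]` with `∫_y^1 g(t) (t-y)^(a-1) dt`. -/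
def fracIntegral (a : ℝ) (g : ℝ → ℝ) (y : ℝ) : ℝ :=
  ∫ r, fracKernel a r * g (y + r)

lemma fracKernel_nonneg (a r : ℝ) : 0 ≤ fracKernel a r :=
  indicator_nonneg (fun _ hr => Real.rpow_nonneg hr.1.le _) _

lemma fracKernel_of_notMem {a r : ℝ} (hr : r ∉ Ioc (0 : ℝ) 1) : fracKernel a r = 0 :=
  indicator_of_notMem hr _

lemma fracKernel_of_nonpos {a r : ℝ} (hr : r ≤ 0) : fracKernel a r = 0 :=
  fracKernel_of_notMem fun h => h.1.not_ge hr

lemma integrable_fracKernel {a : ℝ} (ha : 0 < a) : Integrable (fracKernel a) := by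
  refine IntegrableOn.integrable_indicator ?_ measurableSet_Ioc
  rw [← intervalIntegrable_iff_integrableOn_Ioc_of_le zero_le_one]
  exact intervalIntegral.intervalIntegrable_rpow' (by linarith)

lemma integral_fracKernel_mul (a : ℝ) (g : ℝ → ℝ) :
    ∫ r, fracKernel a r * g r = ∫ r in (0 : ℝ)..1, r ^ (a - 1) * g r := by
  rw [intervalIntegral.integral_of_le zero_le_one, ← integral_indicator measurableSet_Ioc]
  simp only [fracKernel, indicator_mul_left]

lemma integrable_fracKernel_mul {a : ℝ} (ha : 0 < a) {g : ℝ → ℝ} (hg : Continuous g) :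
    Integrable fun r => fracKernel a r * g r := by
  have hon : IntegrableOn (fun r => fracKernel a r * g r) (Icc 0 1) :=
    (integrable_fracKernel ha).integrableOn.mul_continuousOn hg.continuousOn isCompact_Icc
  refine (integrableOn_iff_integrable_of_support_subset fun r hr => ?_).1 hon
  by_contra h
  exact hr (mul_eq_zero_of_left (fracKernel_of_notMem fun h' => h (Ioc_subset_Icc_self h')) _)

lemma abs_fracKernel_mul_le {a c C r : ℝ} (hc : r ∈ Icc (0 : ℝ) 1 → |c| ≤ C) :
    |fracKernel a r * c| ≤ fracKernel a r * C := by
  by_cases hr : r ∈ Ioc (0 : ℝ) 1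
  · rw [abs_mul, abs_of_nonneg (fracKernel_nonneg a r)]
    exact mul_le_mul_of_nonneg_left (hc (Ioc_subset_Icc_self hr)) (fracKernel_nonneg a r)
  · simp [fracKernel_of_notMem hr]

lemma continuous_integral_fracKernel_mul {X : Type*} [TopologicalSpace X]
    [FirstCountableTopology X] [WeaklyLocallyCompactSpace X] {a : ℝ} (ha : 0 < a) {g : X → ℝ → ℝ}
    (hg : Continuous (Function.uncurry g)) :
    Continuous fun x => ∫ r, fracKernel a r * g x r := by
  refine continuous_iff_continuousAt.2 fun x₀ => ?_
  obtain ⟨K, hK, hx₀⟩ := exists_compact_mem_nhds x₀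
  obtain ⟨C, hC⟩ := (hK.prod (isCompact_Icc (a := (0 : ℝ)) (b := 1))).exists_bound_of_continuousOn
    hg.continuousOn
  refine continuousAt_of_dominated (bound := fun r => fracKernel a r * C)
    (Eventually.of_forall fun x => ?_) ?_ ((integrable_fracKernel ha).mul_const C)
    (ae_of_all _ fun r => ?_)
  · exact (integrable_fracKernel_mul ha (hg.uncurry_left x)).aestronglyMeasurable
  · filter_upwards [hx₀] with x hx
    exact ae_of_all _ fun r => abs_fracKernel_mul_le fun hr => hC (x, r) ⟨hx, hr⟩
  · exact (continuous_const.mul (hg.uncurry_right r)).continuousAt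

lemma continuous_fracIntegral {a : ℝ} (ha : 0 < a) {g : ℝ → ℝ} (hg : Continuous g) :
    Continuous (fracIntegral a g) :=
  continuous_integral_fracKernel_mul ha (g := fun y r => g (y + r)) (by fun_prop)

lemma hasDerivAt_fracIntegral {a : ℝ} (ha : 0 < a) {v : ℝ → ℝ} (hv : ContDiff ℝ 1 v) (y : ℝ) :
    HasDerivAt (fracIntegral a v) (fracIntegral a (deriv v) y) y := by
  have hv' : Continuous (deriv v) := hv.continuous_deriv le_rfl
  obtain ⟨C, hC⟩ := (isCompact_Icc (a := y - 1) (b := y + 2)).exists_bound_of_continuousOn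
    hv'.continuousOn
  have hint {g : ℝ → ℝ} (hg : Continuous g) (z : ℝ) :
      Integrable fun r => fracKernel a r * g (z + r) :=
    integrable_fracKernel_mul ha (hg.comp (continuous_const_add z))
  refine (hasDerivAt_integral_of_dominated_loc_of_deriv_le
    (F' := fun z r => fracKernel a r * deriv v (z + r)) (bound := fun r => fracKernel a r * C)
    (Metric.ball_mem_nhds y one_pos) (Eventually.of_forall fun z => ?_) (hint hv.continuous y)
    (hint hv' y).aestronglyMeasurable (ae_of_all _ fun r z hz => ?_)
    ((integrable_fracKernel ha).mul_const C) (ae_of_all _ fun r z _ => ?_)).2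
  · exact (hint hv.continuous z).aestronglyMeasurable
  · refine abs_fracKernel_mul_le fun hr => hC _ ?_
    rw [Real.ball_eq_Ioo] at hz
    exact ⟨by linarith [hz.1, hr.1], by linarith [hz.2, hr.2]⟩
  · exact ((hv.differentiable one_ne_zero _).hasDerivAt.comp_add_const z r).const_mul _

lemma fracIntegral_eq_intervalIntegral (a : ℝ) {y : ℝ} {g : ℝ → ℝ} (hy : y ∈ Icc (0 : ℝ) 1)
    (hg : ∀ t, 1 ≤ t → g t = 0) :
    fracIntegral a g y = ∫ t in y..1, g t * (t - y) ^ (a - 1) := by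
  have hshift : fracIntegral a g y = ∫ t in y..y + 1, g t * (t - y) ^ (a - 1) := by
    have h := intervalIntegral.integral_comp_add_left (fun t => g t * (t - y) ^ (a - 1)) y
      (a := 0) (b := 1)
    simp only [add_sub_cancel_left, add_zero] at h
    rw [← h, fracIntegral, integral_fracKernel_mul a fun r => g (y + r)]
    simp only [mul_comm]
  rw [hshift, intervalIntegral.integral_of_le hy.2, intervalIntegral.integral_of_le (by linarith)]
  refine setIntegral_eq_of_subset_of_forall_sdiff_eq_zero measurableSet_Ioc
    (Ioc_subset_Ioc_right (by linarith [hy.1])) fun t ht => ?_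
  rw [hg t (not_lt.1 fun h => ht.2 ⟨ht.1.1, h.le⟩), zero_mul]

lemma rlDerivRight_eq {s : ℝ} (hs : s < 1) {v : ℝ → ℝ} (hv : ContDiff ℝ 1 v)
    (hv₀ : ∀ t, 1 ≤ t → v t = 0) {x : ℝ} (hx : x ∈ Ioo (0 : ℝ) 1) :
    rlDerivRight s v x = -(1 / Real.Gamma (1 - s)) * fracIntegral (1 - s) (deriv v) x := by
  rw [rlDerivRight]
  congr 1
  refine ((hasDerivAt_fracIntegral (sub_pos.2 hs) hv x).congr_of_eventuallyEq ?_).deriv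
  filter_upwards [isOpen_Ioo.mem_nhds hx] with y hy
  rw [fracIntegral_eq_intervalIntegral _ (Ioo_subset_Icc_self hy) hv₀]
  refine intervalIntegral.integral_congr_ae (ae_of_all _ fun t ht => ?_)
  rw [uIoc_of_le hy.2.le] at ht
  rw [show 1 - s - 1 = -s by ring, Real.rpow_neg (by linarith [ht.1]), div_eq_mul_inv]

lemma intervalIntegral_rpow_mul_rpow {a b z : ℝ} (ha : 0 < a) (hb : 0 < b) (hz : 0 < z) :
    ∫ r in (0 : ℝ)..z, r ^ (a - 1) * (z - r) ^ (b - 1)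
      = z ^ (a + b - 1) * ProbabilityTheory.beta a b := by
  have h := Complex.betaIntegral_scaled a b hz
  rw [← Complex.ofReal_inj, ← intervalIntegral.integral_ofReal]
  have hB : ((ProbabilityTheory.beta a b : ℝ) : ℂ) = Complex.betaIntegral a b := by
    rw [Complex.betaIntegral_eq_Gamma_mul_div _ _ (by simpa) (by simpa), ← Complex.ofReal_add]
    simp only [ProbabilityTheory.beta, Complex.Gamma_ofReal]
    norm_cast
  rw [Complex.ofReal_mul, hB, Complex.ofReal_cpow hz.le]
  push_cast
  rw [← h]
  refine intervalIntegral.integral_congr fun r hr => ?_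
  rw [uIcc_of_le hz.le] at hr
  rw [Complex.ofReal_cpow hr.1, Complex.ofReal_cpow (sub_nonneg.2 hr.2)]
  push_cast
  rfl

lemma integral_fracKernel_mul_fracKernel_sub {a b z : ℝ} (ha : 0 < a) (hb : 0 < b) (hz : z ≤ 1) :
    ∫ r, fracKernel a r * fracKernel b (z - r)
      = ProbabilityTheory.beta a b * fracKernel (a + b) z := by
  rcases le_or_gt z 0 with hz₀ | hz₀
  · rw [fracKernel_of_nonpos hz₀, mul_zero]
    refine integral_eq_zero_of_ae (ae_of_all _ fun r => ?_)
    rcases le_or_gt r 0 with hr | hr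
    · simp [fracKernel_of_nonpos hr]
    · simp [fracKernel_of_nonpos (show z - r ≤ 0 by linarith)]
  · have hz' : fracKernel (a + b) z = z ^ (a + b - 1) :=
      indicator_of_mem (show z ∈ Ioc (0 : ℝ) 1 from ⟨hz₀, hz⟩) _
    rw [hz', mul_comm, ← intervalIntegral_rpow_mul_rpow ha hb hz₀,
      intervalIntegral.integral_of_le hz₀.le, integral_Ioc_eq_integral_Ioo,
      ← integral_indicator measurableSet_Ioo]
    congr 1 with r
    by_cases hr : r ∈ Ioo 0 z
    · have hr₁ : r ∈ Ioc (0 : ℝ) 1 := ⟨hr.1, hr.2.le.trans hz⟩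
      have hr₂ : z - r ∈ Ioc (0 : ℝ) 1 := ⟨sub_pos.2 hr.2, by linarith [hr.1]⟩
      simp only [fracKernel, indicator_of_mem hr, indicator_of_mem hr₁, indicator_of_mem hr₂]
    · rw [indicator_of_notMem hr]
      rcases le_or_gt r 0 with hr₀ | hr₀
      · rw [fracKernel_of_nonpos hr₀, zero_mul]
      · have hrz : z - r ≤ 0 := sub_nonpos.2 (not_lt.1 fun h => hr ⟨hr₀, h⟩)
        rw [fracKernel_of_nonpos hrz, mul_zero]

lemma integrable_fracKernel_mul_fracKernel_sub_mul {a b : ℝ} (ha : 0 < a) (hb : 0 < b)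
    {g : ℝ → ℝ} (hg : Continuous g) :
    Integrable fun q : ℝ × ℝ => fracKernel a q.2 * fracKernel b (q.1 - q.2) * g q.1 := by
  have hconv : Integrable fun q : ℝ × ℝ => fracKernel a q.2 * fracKernel b (q.1 - q.2) :=
    (integrable_fracKernel ha).convolution_integrand (ContinuousLinearMap.mul ℝ ℝ)
      (integrable_fracKernel hb)
  have hon := hconv.integrableOn.mul_continuousOn (hg.comp continuous_fst).continuousOn
    ((isCompact_Icc (a := (0 : ℝ)) (b := 2)).prod (isCompact_Icc (a := (0 : ℝ)) (b := 1)))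
  refine (integrableOn_iff_integrable_of_support_subset fun q hq => ?_).1 hon
  have h₂ : q.2 ∈ Ioc (0 : ℝ) 1 := by
    by_contra h
    exact hq (by simp [fracKernel_of_notMem h])
  have h₁ : q.1 - q.2 ∈ Ioc (0 : ℝ) 1 := by
    by_contra h
    exact hq (by simp [fracKernel_of_notMem h])
  exact ⟨⟨by linarith [h₁.1, h₂.1], by linarith [h₁.2, h₂.2]⟩, Ioc_subset_Icc_self h₂⟩

lemma fracIntegral_fracIntegral {a b : ℝ} (ha : 0 < a) (hb : 0 < b) {g : ℝ → ℝ}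
    (hg : Continuous g) (hg₀ : ∀ t, 1 ≤ t → g t = 0) {y : ℝ} (hy : 0 ≤ y) :
    fracIntegral a (fracIntegral b g) y
      = ProbabilityTheory.beta a b * fracIntegral (a + b) g y := by
  have hint := integrable_fracKernel_mul_fracKernel_sub_mul ha hb (hg.comp (continuous_const_add y))
  calc fracIntegral a (fracIntegral b g) y
      = ∫ r, ∫ z, fracKernel a r * fracKernel b (z - r) * g (y + z) := by
        simp only [fracIntegral]
        congr 1 with r
        rw [← integral_add_left_eq_self
          (fun z => fracKernel a r * fracKernel b (z - r) * g (y + z)) r, ← integral_const_mul]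
        simp only [add_sub_cancel_left, mul_assoc, add_assoc]
    _ = ∫ z, ∫ r, fracKernel a r * fracKernel b (z - r) * g (y + z) :=
        (integral_integral_swap hint).symm
    _ = ∫ z, ProbabilityTheory.beta a b * (fracKernel (a + b) z * g (y + z)) := by
        congr 1 with z
        rw [integral_mul_const]
        rcases le_or_gt z 1 with hz | hz
        · rw [integral_fracKernel_mul_fracKernel_sub ha hb hz, mul_assoc]
        · rw [hg₀ (y + z) (by linarith)]
          simp
    _ = ProbabilityTheory.beta a b * fracIntegral (a + b) g y := integral_const_mul _ _

lemma deriv_eq_zero_of_eq_zero {v : ℝ → ℝ} (hv : ContDiff ℝ 1 v) {c : ℝ}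
    (hv₀ : ∀ t, c ≤ t → v t = 0) {t : ℝ} (ht : c ≤ t) : deriv v t = 0 := by
  have hderiv : HasDerivWithinAt v (deriv v t) (Ici t) t :=
    (hv.differentiable one_ne_zero t).hasDerivAt.hasDerivWithinAt
  exact (uniqueDiffWithinAt_Ici t).eq_deriv _ hderiv <|
    (hasDerivWithinAt_const t (Ici t) (0 : ℝ)).congr (fun y hy => hv₀ y (ht.trans hy)) (hv₀ t ht)

theorem abel_inversion {s : ℝ} (hs : s ∈ Ioo (0 : ℝ) 1) {v : ℝ → ℝ} (hv : ContDiff ℝ 1 v)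
    (hv₀ : ∀ t, 1 ≤ t → v t = 0) {x : ℝ} (hx : 0 ≤ x) :
    fracIntegral (1 - s) (fracIntegral s (deriv v)) x
      = -ProbabilityTheory.beta (1 - s) s * v x := by
  have hone : fracIntegral 1 (deriv v) x = -v x := by
    rw [fracIntegral, integral_fracKernel_mul 1 fun r => deriv v (x + r)]
    simp only [sub_self, Real.rpow_zero, one_mul]
    rw [intervalIntegral.integral_comp_add_left (fun r => deriv v r) x,
      intervalIntegral.integral_deriv_eq_sub (fun t _ => hv.differentiable one_ne_zero t)
        ((hv.continuous_deriv le_rfl).intervalIntegrable _ _), hv₀ (x + 1) (by linarith)]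
    simp
  rw [fracIntegral_fracIntegral (sub_pos.2 hs.2) hs.1 (hv.continuous_deriv le_rfl)
    (fun _ ht => deriv_eq_zero_of_eq_zero hv hv₀ ht) hx, sub_add_cancel, hone, mul_neg, neg_mul]

lemma fracIntegral_sub {a : ℝ} (ha : 0 < a) {g h : ℝ → ℝ} (hg : Continuous g)
    (hh : Continuous h) (y : ℝ) :
    fracIntegral a (fun t => g t - h t) y = fracIntegral a g y - fracIntegral a h y := by
  simp only [fracIntegral, mul_sub]
  exact integral_sub (integrable_fracKernel_mul ha (hg.comp (continuous_const_add y)))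
    (integrable_fracKernel_mul ha (hh.comp (continuous_const_add y)))

lemma fracIntegral_const_mul (a c : ℝ) (g : ℝ → ℝ) (y : ℝ) :
    fracIntegral a (fun t => c * g t) y = c * fracIntegral a g y := by
  simp only [fracIntegral, ← integral_const_mul, mul_left_comm]

lemma contDiff_one_fracIntegral {a : ℝ} (ha : 0 < a) {v : ℝ → ℝ} (hv : ContDiff ℝ 1 v) :
    ContDiff ℝ 1 (fracIntegral a v) := by
  have hderiv := hasDerivAt_fracIntegral ha hv
  rw [contDiff_one_iff_deriv, funext fun y => (hderiv y).deriv]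
  exact ⟨fun y => (hderiv y).differentiableAt,
    continuous_fracIntegral ha (hv.continuous_deriv le_rfl)⟩

lemma abs_fracIntegral_le_of_eqOn_zero {a : ℝ} (ha : 0 < a) {g : ℝ → ℝ} {c C y : ℝ} (hy : 0 ≤ y)
    (hc : 0 ≤ c) (hC : 0 ≤ C) (hg : ∀ t ∈ Icc 0 c, |g t| ≤ C) (hg₀ : ∀ t, c < t → g t = 0) :
    |fracIntegral a g y| ≤ C * ∫ r in (0 : ℝ)..c, fracKernel a r := by
  rw [intervalIntegral.integral_of_le hc, ← integral_indicator measurableSet_Ioc,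
    ← integral_const_mul]
  refine norm_integral_le_of_norm_le (f := fun r => fracKernel a r * g (y + r))
    (((integrable_fracKernel ha).indicator measurableSet_Ioc).const_mul C)
    (ae_of_all _ fun r => ?_)
  rw [norm_mul, Real.norm_of_nonneg (fracKernel_nonneg _ _), Real.norm_eq_abs]
  by_cases hr : r ∈ Ioc 0 c
  · rw [indicator_of_mem hr, mul_comm]
    refine mul_le_mul_of_nonneg_right ?_ (fracKernel_nonneg _ _)
    rcases le_or_gt (y + r) c with h | h
    · exact hg _ ⟨add_nonneg hy hr.1.le, h⟩
    · rwa [hg₀ _ h, abs_zero]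
  · rw [indicator_of_notMem hr, mul_zero]
    rcases le_or_gt r 0 with hr₀ | hr₀
    · rw [fracKernel_of_nonpos hr₀, zero_mul]
    · have hcr : c < r := not_le.1 fun h => hr ⟨hr₀, h⟩
      rw [hg₀ _ (by linarith), abs_zero, mul_zero]

lemma tendsto_intervalIntegral_fracKernel {a : ℝ} (ha : 0 < a) :
    Tendsto (fun c => ∫ r in (0 : ℝ)..c, fracKernel a r) (𝓝 0) (𝓝 0) := by
  have h := (intervalIntegral.continuous_primitive
    (fun b c => (integrable_fracKernel ha).intervalIntegrable (a := b) (b := c)) 0).tendsto 0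
  rwa [intervalIntegral.integral_same] at h

/-- The smooth cutoff that vanishes on `(-∞, ε]` and equals `1` on `[2 ε, ∞)`. -/
def cutoff (ε t : ℝ) : ℝ := Real.smoothTransition (t / ε - 1)

lemma contDiff_cutoff (ε : ℝ) {n : ℕ∞} : ContDiff ℝ n (cutoff ε) :=
  Real.smoothTransition.contDiff.comp ((contDiff_id.div_const ε).sub contDiff_const)

lemma cutoff_eq_zero {ε t : ℝ} (hε : 0 < ε) (ht : t ≤ ε) : cutoff ε t = 0 :=
  Real.smoothTransition.zero_of_nonpos (sub_nonpos.2 ((div_le_one hε).2 ht))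

lemma cutoff_eq_one {ε t : ℝ} (hε : 0 < ε) (ht : 2 * ε ≤ t) : cutoff ε t = 1 :=
  Real.smoothTransition.one_of_one_le (by
    rw [le_sub_iff_add_le, le_div_iff₀ hε]
    linarith)

lemma cutoff_nonneg (ε t : ℝ) : 0 ≤ cutoff ε t := Real.smoothTransition.nonneg _

lemma cutoff_le_one (ε t : ℝ) : cutoff ε t ≤ 1 := Real.smoothTransition.le_one _

lemma exists_abs_deriv_cutoff_le :
    ∃ M, 0 ≤ M ∧ ∀ ε t, 0 < ε → t ∈ Icc 0 (2 * ε) → |deriv (cutoff ε) t| ≤ M / ε := by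
  have hsmooth : ContDiff ℝ 1 Real.smoothTransition := Real.smoothTransition.contDiff
  obtain ⟨M, hM⟩ := (isCompact_Icc (a := (-1 : ℝ)) (b := 1)).exists_bound_of_continuousOn
    (hsmooth.continuous_deriv le_rfl).continuousOn
  refine ⟨M, (norm_nonneg _).trans (hM 0 (by simp)), fun ε t hε ht => ?_⟩
  have hderiv : HasDerivAt (cutoff ε) (deriv Real.smoothTransition (t / ε - 1) * (1 / ε)) t :=
    HasDerivAt.comp (h₂ := Real.smoothTransition) t
      (hsmooth.differentiable one_ne_zero _).hasDerivAt
      (((hasDerivAt_id t).div_const ε).sub_const 1)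
  rw [hderiv.deriv, abs_mul, abs_of_pos (one_div_pos.2 hε), mul_one_div]
  have h₀ : 0 ≤ t / ε := div_nonneg ht.1 hε.le
  have h₂ : t / ε ≤ 2 := (div_le_iff₀ hε).2 ht.2
  exact div_le_div_of_nonneg_right (hM _ ⟨by linarith, by linarith⟩) hε.le

lemma abs_le_mul_of_abs_deriv_le {V : ℝ → ℝ} (hV : Differentiable ℝ V) (hV₀ : V 0 = 0)
    {L : ℝ} (hL : ∀ t ∈ Icc (0 : ℝ) 1, |deriv V t| ≤ L) {t : ℝ} (ht : t ∈ Icc (0 : ℝ) 1) :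
    |V t| ≤ L * t := by
  have h := (convex_Icc (0 : ℝ) 1).norm_image_sub_le_of_norm_deriv_le
    (fun t _ => hV t) hL (left_mem_Icc.2 zero_le_one) ht
  simpa [hV₀, abs_of_nonneg ht.1] using h

/-- Since `V 0 = 0`, the derivative of the cutoff, of order `1 / ε`, meets values of `V` of
order `ε`: the product has a bounded derivative, which vanishes off an interval of length `2 ε`. -/
lemma exists_abs_fracIntegral_deriv_one_sub_cutoff_mul_le {a : ℝ} (ha : 0 < a) :
    ∃ M, ∀ {V : ℝ → ℝ} {L ε y : ℝ}, Differentiable ℝ V → V 0 = 0 →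
      (∀ t ∈ Icc (0 : ℝ) 1, |deriv V t| ≤ L) → 0 < ε → 2 * ε ≤ 1 → 0 ≤ y →
      |fracIntegral a (deriv fun t => (1 - cutoff ε t) * V t) y|
        ≤ M * L * ∫ r in (0 : ℝ)..(2 * ε), fracKernel a r := by
  obtain ⟨M, hM₀, hM⟩ := exists_abs_deriv_cutoff_le
  refine ⟨2 * M + 1, fun {V L ε y} hV hV₀ hL hε hε₁ hy => ?_⟩
  have hL₀ : 0 ≤ L := (abs_nonneg _).trans (hL 0 (by simp))
  refine abs_fracIntegral_le_of_eqOn_zero ha hy (by linarith) (by positivity) (fun t ht => ?_)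
    fun t ht => ?_
  · have ht₁ : t ∈ Icc (0 : ℝ) 1 := ⟨ht.1, ht.2.trans hε₁⟩
    have hderiv : HasDerivAt (fun t => (1 - cutoff ε t) * V t)
        (-deriv (cutoff ε) t * V t + (1 - cutoff ε t) * deriv V t) t :=
      (((contDiff_cutoff ε (n := 1)).differentiable one_ne_zero t).hasDerivAt.const_sub 1).mul
        (hV t).hasDerivAt
    calc |deriv (fun t => (1 - cutoff ε t) * V t) t|
        ≤ |deriv (cutoff ε) t| * |V t| + (1 - cutoff ε t) * |deriv V t| := by
          rw [hderiv.deriv]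
          refine (abs_add_le _ _).trans ?_
          rw [abs_mul, abs_mul, abs_neg, abs_of_nonneg (sub_nonneg.2 (cutoff_le_one ε t))]
      _ ≤ M / ε * (L * (2 * ε)) + 1 * L := by
          gcongr
          · exact hM ε t hε ht
          · exact (abs_le_mul_of_abs_deriv_le hV hV₀ hL ht₁).trans
              (mul_le_mul_of_nonneg_left ht.2 hL₀)
          · linarith [cutoff_nonneg ε t]
          · exact hL t ht₁
      _ = (2 * M + 1) * L := by field_simp
  · have hzero : (fun t => (1 - cutoff ε t) * V t) =ᶠ[𝓝 t] fun _ => 0 := by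
      filter_upwards [lt_mem_nhds ht] with z hz
      rw [cutoff_eq_one hε hz.le, sub_self, zero_mul]
    rw [hzero.deriv_eq, deriv_const]

/-- The modification of `W` near `0` that vanishes at `0` and agrees with `W` on `[1/2, ∞)`. -/
def vanishAtZero (W : ℝ → ℝ) (t : ℝ) : ℝ :=
  W t - W 0 * (1 - cutoff (1 / 4) t)

lemma vanishAtZero_zero (W : ℝ → ℝ) : vanishAtZero W 0 = 0 := by
  rw [vanishAtZero, cutoff_eq_zero (by norm_num) (by norm_num), sub_zero, mul_one, sub_self]

lemma vanishAtZero_of_half_le (W : ℝ → ℝ) {t : ℝ} (ht : 1 / 2 ≤ t) : vanishAtZero W t = W t := by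
  rw [vanishAtZero, cutoff_eq_one (by norm_num) (by linarith), sub_self, mul_zero, sub_zero]

lemma abs_vanishAtZero_le {W : ℝ → ℝ} {δ : ℝ} (hW : ∀ t, |W t| ≤ δ) (t : ℝ) :
    |vanishAtZero W t| ≤ 2 * δ := by
  have hcut : |1 - cutoff (1 / 4) t| ≤ 1 := by
    rw [abs_le]
    constructor <;> linarith [cutoff_nonneg (1 / 4) t, cutoff_le_one (1 / 4) t]
  calc |vanishAtZero W t| ≤ |W t| + |W 0| * |1 - cutoff (1 / 4) t| := by
        rw [← abs_mul]
        exact abs_sub _ _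
    _ ≤ δ + δ * 1 := by
        gcongr
        exacts [hW t, (abs_nonneg _).trans (hW 0), hW 0]
    _ = 2 * δ := by ring

lemma contDiff_vanishAtZero {W : ℝ → ℝ} {n : ℕ∞} (hW : ContDiff ℝ n W) :
    ContDiff ℝ n (vanishAtZero W) :=
  hW.sub (contDiff_const.mul (contDiff_const.sub (contDiff_cutoff _)))

lemma deriv_cutoff_mul_vanishAtZero {W : ℝ → ℝ} (hW : ContDiff ℝ 1 W) (ε t : ℝ) :
    deriv (fun t => cutoff ε t * vanishAtZero W t) t
      = deriv W t - -W 0 * deriv (cutoff (1 / 4)) t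
        - deriv (fun t => (1 - cutoff ε t) * vanishAtZero W t) t := by
  have hderiv {f : ℝ → ℝ} (hf : ContDiff ℝ 1 f) : HasDerivAt f (deriv f t) t :=
    (hf.differentiable one_ne_zero t).hasDerivAt
  have hR : ContDiff ℝ 1 fun t => (1 - cutoff ε t) * vanishAtZero W t :=
    (contDiff_const.sub (contDiff_cutoff ε)).mul (contDiff_vanishAtZero hW)
  refine HasDerivAt.deriv ?_
  convert ((hderiv hW).sub (((hderiv (contDiff_cutoff (1 / 4))).const_sub 1).const_mul (W 0))).sub
    (hderiv hR) using 1
  · ext t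
    simp only [vanishAtZero, Pi.sub_apply]
    ring
  · ring

lemma fracIntegral_deriv_cutoff_mul {s : ℝ} (hs : s ∈ Ioo (0 : ℝ) 1) {v : ℝ → ℝ}
    (hv : ContDiff ℝ 1 v) (hv₀ : ∀ t, 1 ≤ t → v t = 0) (ε : ℝ) {x : ℝ} (hx : 0 ≤ x) :
    fracIntegral (1 - s) (deriv fun t => cutoff ε t * vanishAtZero (fracIntegral s v) t) x
      = -ProbabilityTheory.beta (1 - s) s * v x
        + fracIntegral s v 0 * fracIntegral (1 - s) (deriv (cutoff (1 / 4))) x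
        - fracIntegral (1 - s)
            (deriv fun t => (1 - cutoff ε t) * vanishAtZero (fracIntegral s v) t) x := by
  have hs' : 0 < 1 - s := sub_pos.2 hs.2
  have hW : ContDiff ℝ 1 (fracIntegral s v) := contDiff_one_fracIntegral hs.1 hv
  have hWderiv : deriv (fracIntegral s v) = fracIntegral s (deriv v) :=
    funext fun y => (hasDerivAt_fracIntegral hs.1 hv y).deriv
  have hcont₁ : Continuous (deriv (fracIntegral s v)) := hW.continuous_deriv le_rfl
  have hcont₂ : Continuous fun t => -fracIntegral s v 0 * deriv (cutoff (1 / 4)) t :=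
    continuous_const.mul ((contDiff_cutoff (1 / 4) (n := 1)).continuous_deriv le_rfl)
  have hcont₃ : Continuous
      (deriv fun t => (1 - cutoff ε t) * vanishAtZero (fracIntegral s v) t) :=
    ((contDiff_const.sub (contDiff_cutoff ε (n := 1))).mul
      (contDiff_vanishAtZero hW)).continuous_deriv le_rfl
  have hcont₁₂ : Continuous fun t =>
      deriv (fracIntegral s v) t - -fracIntegral s v 0 * deriv (cutoff (1 / 4)) t :=
    hcont₁.sub hcont₂
  rw [funext (deriv_cutoff_mul_vanishAtZero hW ε), fracIntegral_sub hs' hcont₁₂ hcont₃,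
    fracIntegral_sub hs' hcont₁ hcont₂, fracIntegral_const_mul, hWderiv,
    abel_inversion hs hv hv₀ hx]
  ring

theorem exists_abs_fracIntegral_deriv_cutoff_mul_add_le {s : ℝ} (hs : s ∈ Ioo (0 : ℝ) 1) :
    ∃ C M, 0 ≤ C ∧ ∀ {v : ℝ → ℝ} {L ε x : ℝ}, ContDiff ℝ 1 v → (∀ t, 1 ≤ t → v t = 0) →
      (∀ t ∈ Icc (0 : ℝ) 1, |deriv (vanishAtZero (fracIntegral s v)) t| ≤ L) →
      0 < ε → 2 * ε ≤ 1 → x ∈ Icc (0 : ℝ) 1 →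
      |fracIntegral (1 - s) (deriv fun t => cutoff ε t * vanishAtZero (fracIntegral s v) t) x
          + ProbabilityTheory.beta (1 - s) s * v x|
        ≤ C * |fracIntegral s v 0|
          + M * L * ∫ r in (0 : ℝ)..(2 * ε), fracKernel (1 - s) r := by
  have hs' : 0 < 1 - s := sub_pos.2 hs.2
  have hcont : Continuous (fracIntegral (1 - s) (deriv (cutoff (1 / 4)))) :=
    continuous_fracIntegral hs' ((contDiff_cutoff (1 / 4) (n := 1)).continuous_deriv le_rfl)
  obtain ⟨C, hC⟩ := (isCompact_Icc (a := (0 : ℝ)) (b := 1)).exists_bound_of_continuousOn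
    hcont.continuousOn
  obtain ⟨M, hM⟩ := exists_abs_fracIntegral_deriv_one_sub_cutoff_mul_le hs'
  refine ⟨C, M, (norm_nonneg _).trans (hC 0 (by simp)), fun {v L ε x} hv hv₀ hL hε hε₁ hx => ?_⟩
  have hV : Differentiable ℝ (vanishAtZero (fracIntegral s v)) :=
    (contDiff_vanishAtZero (n := 1) (contDiff_one_fracIntegral hs.1 hv)).differentiable one_ne_zero
  have herror := hM hV (vanishAtZero_zero _) hL hε hε₁ hx.1
  rw [fracIntegral_deriv_cutoff_mul hs hv hv₀ ε hx.1]
  calc _ = |fracIntegral (1 - s) (deriv (cutoff (1 / 4))) x * fracIntegral s v 0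
          - fracIntegral (1 - s)
            (deriv fun t => (1 - cutoff ε t) * vanishAtZero (fracIntegral s v) t) x| := by
        congr 1
        ring
    _ ≤ _ := by
        refine (abs_sub _ _).trans (add_le_add ?_ herror)
        rw [abs_mul]
        exact mul_le_mul_of_nonneg_right (hC x hx) (abs_nonneg _)

/-! ### Partial fractional integrals on the cube -/

variable {N : ℕ}

/-- The partial derivative in the direction of the `i`-th coordinate. -/
def partialDeriv (i : Fin N) (f : (Fin N → ℝ) → ℝ) (x : Fin N → ℝ) : ℝ :=
  fderiv ℝ f x (Pi.single i 1)

/-- The truncated fractional integral in the `i`-th variable. -/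
def partialFracIntegral (a : ℝ) (i : Fin N) (g : (Fin N → ℝ) → ℝ) (x : Fin N → ℝ) : ℝ :=
  fracIntegral a (fun t => g (Function.update x i t)) (x i)

lemma contDiff_update_prod (i : Fin N) {n : ℕ∞} :
    ContDiff ℝ n fun q : (Fin N → ℝ) × ℝ => Function.update q.1 i q.2 := by
  refine contDiff_pi.2 fun j => ?_
  rcases eq_or_ne j i with rfl | hj
  · simpa only [Function.update_self] using contDiff_snd
  · simp only [Function.update_of_ne hj]
    exact (contDiff_apply ℝ ℝ j).comp contDiff_fst

lemma deriv_comp_update {f : (Fin N → ℝ) → ℝ} (hf : Differentiable ℝ f) (i : Fin N)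
    (x : Fin N → ℝ) :
    (deriv fun t => f (Function.update x i t))
      = fun t => partialDeriv i f (Function.update x i t) :=
  funext fun t =>
    ((hf (Function.update x i t)).hasFDerivAt.comp_hasDerivAt t (hasDerivAt_update x i t)).deriv

lemma contDiff_comp_update {n : ℕ∞} {f : (Fin N → ℝ) → ℝ} (hf : ContDiff ℝ n f) (i : Fin N)
    (x : Fin N → ℝ) : ContDiff ℝ n fun t => f (Function.update x i t) :=
  hf.comp (contDiff_update n x i)

lemma continuous_partialDeriv {f : (Fin N → ℝ) → ℝ} (hf : ContDiff ℝ 1 f) (i : Fin N) :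
    Continuous (partialDeriv i f) :=
  (hf.continuous_fderiv one_ne_zero).clm_apply continuous_const

lemma partialFracIntegral_update (a : ℝ) (i : Fin N) (g : (Fin N → ℝ) → ℝ) (x : Fin N → ℝ) (t : ℝ) :
    partialFracIntegral a i g (Function.update x i t)
      = fracIntegral a (fun t => g (Function.update x i t)) t := by
  simp only [partialFracIntegral, Function.update_idem, Function.update_self]

lemma partialFracIntegral_partialDeriv (a : ℝ) (i : Fin N) {f : (Fin N → ℝ) → ℝ}
    (hf : Differentiable ℝ f) (x : Fin N → ℝ) :
    partialFracIntegral a i (partialDeriv i f) x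
      = fracIntegral a (deriv fun t => f (Function.update x i t)) (x i) := by
  rw [deriv_comp_update hf, partialFracIntegral]

lemma continuous_partialFracIntegral {a : ℝ} (ha : 0 < a) (i : Fin N) {g : (Fin N → ℝ) → ℝ}
    (hg : Continuous g) : Continuous (partialFracIntegral a i g) :=
  continuous_integral_fracKernel_mul ha (g := fun x r => g (Function.update x i (x i + r)))
    (hg.comp (continuous_fst.update i (((continuous_apply i).comp continuous_fst).add
      continuous_snd)))

lemma contDiff_partialFracIntegral {a : ℝ} (ha : 0 < a) (i : Fin N) {n : ℕ∞} {f : (Fin N → ℝ) → ℝ}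
    (hf : ContDiff ℝ n f) (hc : HasCompactSupport f) :
    ContDiff ℝ n (partialFracIntegral a i f) := by
  obtain ⟨C, hC⟩ := hc.isCompact.isBounded.subset_closedBall (0 : Fin N → ℝ)
  refine contDiff_iff_contDiffAt.2 fun x₀ => ?_
  obtain ⟨R, hR⟩ : ∃ R, ‖x₀‖ < R := exists_gt _
  have hvanish (x : Fin N → ℝ) (y : ℝ) (hx : x ∈ Metric.ball (0 : Fin N → ℝ) R)
      (hy : y ∉ Icc (-(R + C)) (R + C)) : f (Function.update x i (x i - y)) = 0 := by
    by_contra h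
    have hxi : |x i| ≤ R := (norm_le_pi_norm x i).trans (mem_ball_zero_iff.1 hx).le
    have hyi : ‖Function.update x i (x i - y)‖ ≤ C := by
      simpa using hC (subset_tsupport _ h)
    have hxy := (norm_le_pi_norm _ i).trans hyi
    rw [Function.update_self, Real.norm_eq_abs] at hxy
    have hy' := abs_sub (x i) (x i - y)
    rw [sub_sub_cancel] at hy'
    exact hy (abs_le.1 (by linarith))
  have hsmooth : ContDiff ℝ n fun q : (Fin N → ℝ) × ℝ => f (Function.update q.1 i (q.1 i - q.2)) :=
    hf.comp ((contDiff_update_prod i).comp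
      (contDiff_fst.prodMk (((contDiff_apply ℝ ℝ i).comp contDiff_fst).sub contDiff_snd)))
  have hconv := contDiffOn_convolution_right_with_param_comp (μ := (volume : Measure ℝ))
    (ContinuousLinearMap.mul ℝ ℝ) (s := Metric.ball (0 : Fin N → ℝ) R) (v := fun _ => (0 : ℝ))
    contDiffOn_const (f := fracKernel a) (g := fun x y => f (Function.update x i (x i - y)))
    Metric.isOpen_ball isCompact_Icc hvanish
    (integrable_fracKernel ha).locallyIntegrable hsmooth.contDiffOn
  refine (hconv.contDiffAt (Metric.isOpen_ball.mem_nhds (mem_ball_zero_iff.2 hR))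
    ).congr_of_eventuallyEq (Eventually.of_forall fun x => ?_)
  simp [convolution, partialFracIntegral, fracIntegral]

/-- `partialFracIntegral s i f`, corrected so that it vanishes on the hyperplane `x i = 0`. -/
def correctedFracIntegral (s : ℝ) (i : Fin N) (f : (Fin N → ℝ) → ℝ) (x : Fin N → ℝ) : ℝ :=
  vanishAtZero (fun t => partialFracIntegral s i f (Function.update x i t)) (x i)

lemma correctedFracIntegral_update (s : ℝ) (i : Fin N) (f : (Fin N → ℝ) → ℝ) (x : Fin N → ℝ)
    (t : ℝ) :
    correctedFracIntegral s i f (Function.update x i t)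
      = vanishAtZero (fracIntegral s fun t => f (Function.update x i t)) t := by
  simp only [correctedFracIntegral, partialFracIntegral_update, Function.update_idem,
    Function.update_self]

lemma contDiff_correctedFracIntegral {s : ℝ} (hs : 0 < s) (i : Fin N) {n : ℕ∞}
    {f : (Fin N → ℝ) → ℝ} (hf : ContDiff ℝ n f) (hc : HasCompactSupport f) :
    ContDiff ℝ n (correctedFracIntegral s i f) := by
  have hW : ContDiff ℝ n (partialFracIntegral s i f) := contDiff_partialFracIntegral hs i hf hc
  have hW₀ : ContDiff ℝ n fun x => partialFracIntegral s i f (Function.update x i 0) :=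
    hW.comp ((contDiff_update_prod i).comp (contDiff_id.prodMk contDiff_const))
  simp only [funext fun x => show correctedFracIntegral s i f x = _ by
    rw [correctedFracIntegral, vanishAtZero, Function.update_eq_self]]
  exact hW.sub (hW₀.mul (contDiff_const.sub ((contDiff_cutoff _).comp (contDiff_apply ℝ ℝ i))))

lemma abs_correctedFracIntegral_le {s δ : ℝ} {i : Fin N} {f : (Fin N → ℝ) → ℝ}
    (hδ : ∀ x, |partialFracIntegral s i f x| ≤ δ) (x : Fin N → ℝ) :
    |correctedFracIntegral s i f x| ≤ 2 * δ :=
  abs_vanishAtZero_le (fun _ => hδ _) _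

lemma measurableSet_cube : MeasurableSet (cube N) :=
  MeasurableSet.univ_pi fun _ => measurableSet_Ioo

lemma isOpen_cube : IsOpen (cube N) :=
  isOpen_set_pi finite_univ fun _ _ => isOpen_Ioo

lemma cube_subset_Icc : cube N ⊆ Icc 0 1 := fun _ hx =>
  ⟨fun j => (hx j (mem_univ j)).1.le, fun j => (hx j (mem_univ j)).2.le⟩

/-- `f` is supported in the closed box `[α, 1-α]^N`. -/
def BoxSupported (α : ℝ) (f : (Fin N → ℝ) → ℝ) : Prop :=
  ∀ x, f x ≠ 0 → ∀ j, x j ∈ Icc α (1 - α)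

namespace BoxSupported

variable {s α : ℝ} {i : Fin N} {f : (Fin N → ℝ) → ℝ}

lemma tsupport_subset (h : BoxSupported α f) : tsupport f ⊆ univ.pi fun _ => Icc α (1 - α) :=
  closure_minimal (fun x hx j _ => h x hx j) (isClosed_set_pi fun _ _ => isClosed_Icc)

lemma hasCompactSupport (h : BoxSupported α f) : HasCompactSupport f :=
  (isCompact_univ_pi fun _ => isCompact_Icc).of_isClosed_subset (isClosed_tsupport f)
    h.tsupport_subset

lemma tsupport_subset_cube (h : BoxSupported α f) (hα : 0 < α) : tsupport f ⊆ cube N :=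
  fun _ hx j hj => Icc_subset_Ioo hα (by linarith) (h.tsupport_subset hx j hj)

lemma partialFracIntegral (hf : BoxSupported α f) {x : Fin N → ℝ}
    (hx : partialFracIntegral s i f x ≠ 0) :
    (∀ j, j ≠ i → x j ∈ Icc α (1 - α)) ∧ x i ≤ 1 - α := by
  obtain ⟨r, hr⟩ : ∃ r, fracKernel s r * f (Function.update x i (x i + r)) ≠ 0 := by
    by_contra! h
    exact hx (by simp only [FracBV.partialFracIntegral, fracIntegral, h, integral_zero])
  have hr₀ : 0 < r := not_le.1 fun h => left_ne_zero_of_mul hr (fracKernel_of_nonpos h)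
  have hbox := hf _ (right_ne_zero_of_mul hr)
  refine ⟨fun j hj => by simpa only [Function.update_of_ne hj] using hbox j, ?_⟩
  have hi := (hbox i).2
  rw [Function.update_self] at hi
  linarith

lemma correctedFracIntegral (hf : BoxSupported α f) {x : Fin N → ℝ}
    (hx : correctedFracIntegral s i f x ≠ 0) :
    (∀ j, j ≠ i → x j ∈ Icc α (1 - α)) ∧ x i ≤ 1 - α := by
  by_cases hW : FracBV.partialFracIntegral s i f x = 0
  · have hW₀ : FracBV.partialFracIntegral s i f (Function.update x i 0) ≠ 0 := by
      intro h
      exact hx (by simp [FracBV.correctedFracIntegral, vanishAtZero, hW, h])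
    have hbox := hf.partialFracIntegral hW₀
    refine ⟨fun j hj => by simpa only [Function.update_of_ne hj] using hbox.1 j hj, ?_⟩
    have hα : α ≤ 1 / 2 := by
      obtain ⟨y, hy⟩ : ∃ y, f y ≠ 0 := by
        by_contra! h
        exact hW₀ (by simp [FracBV.partialFracIntegral, fracIntegral, h])
      linarith [(hf y hy i).1, (hf y hy i).2]
    by_contra! h
    rw [FracBV.correctedFracIntegral, vanishAtZero_of_half_le _ (by linarith),
      Function.update_eq_self] at hx
    exact hx hW
  · exact hf.partialFracIntegral hW

lemma cutoff_mul_correctedFracIntegral (hf : BoxSupported α f) {ε : ℝ} (hε : 0 < ε) :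
    BoxSupported (min ε α) fun x => cutoff ε (x i) * FracBV.correctedFracIntegral s i f x := by
  intro x hx j
  have hbox := hf.correctedFracIntegral (right_ne_zero_of_mul hx)
  have hmin := min_le_right ε α
  rcases eq_or_ne j i with rfl | hj
  · refine ⟨?_, by linarith⟩
    by_contra! h
    exact left_ne_zero_of_mul hx (cutoff_eq_zero hε (h.le.trans (min_le_left _ _)))
  · exact ⟨hmin.trans (hbox.1 j hj).1, by linarith [(hbox.1 j hj).2]⟩

end BoxSupported

lemma exists_boxSupported {f : (Fin N → ℝ) → ℝ} (hc : HasCompactSupport f)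
    (hsub : tsupport f ⊆ cube N) : ∃ α, 0 < α ∧ BoxSupported α f := by
  obtain ⟨α, hα, hthick⟩ := hc.isCompact.exists_cthickening_subset_open isOpen_cube hsub
  refine ⟨α, hα, fun x hx j => ?_⟩
  have hshift (c : ℝ) (hc : |c| ≤ α) : x j + c ∈ Ioo (0 : ℝ) 1 := by
    have hmem : (fun k => x k + c) ∈ cube N :=
      hthick (Metric.closedBall_subset_cthickening (subset_tsupport f hx) α
        ((dist_pi_le_iff hα.le).2 fun k => by simpa [Real.dist_eq] using hc))
    exact hmem j (mem_univ j)
  have hlow := (hshift (-α) (by rw [abs_neg, abs_of_pos hα])).1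
  have hhigh := (hshift α (abs_of_pos hα).le).2
  exact ⟨by linarith, by linarith⟩

lemma eq_zero_of_tsupport_subset_cube {E : Type*} [Zero E] {f : (Fin N → ℝ) → E}
    (hsub : tsupport f ⊆ cube N) {x : Fin N → ℝ} {i : Fin N} (hx : 1 ≤ x i) : f x = 0 := by
  by_contra h
  exact hx.not_gt (hsub (subset_tsupport f h) i (mem_univ i)).2

lemma rlPartialRight_eq {s : ℝ} (hs : s < 1) (i : Fin N) {w : (Fin N → ℝ) → ℝ}
    (hw : ContDiff ℝ 1 w) (hw₀ : ∀ x, 1 ≤ x i → w x = 0) {x : Fin N → ℝ}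
    (hx : x i ∈ Ioo (0 : ℝ) 1) :
    rlPartialRight s i w x
      = -(1 / Real.Gamma (1 - s)) * partialFracIntegral (1 - s) i (partialDeriv i w) x := by
  rw [rlPartialRight, rlDerivRight_eq hs (contDiff_comp_update hw i x)
    (fun t ht => hw₀ _ (by rwa [Function.update_self])) hx,
    partialFracIntegral_partialDeriv _ i (hw.differentiable one_ne_zero)]

lemma rlPartialRight_zero (s : ℝ) (i : Fin N) (x : Fin N → ℝ) :
    rlPartialRight s i (fun _ => 0) x = 0 := by
  simp [rlPartialRight, rlDerivRight]

/-- The normalizing constant of the fractional divergence. -/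
def divConst (N : ℕ) (s : ℝ) : ℝ := (1 - 1 / (N : ℝ)) * s + 1 / (N : ℝ)

lemma divConst_pos (hN : 1 ≤ N) {s : ℝ} (hs : 0 ≤ s) : 0 < divConst N s := by
  have hN' : 1 / (N : ℝ) ≤ 1 := div_le_one_of_le₀ (by exact_mod_cast hN) N.cast_nonneg
  have hpos : 0 < 1 / (N : ℝ) := by positivity
  exact add_pos_of_nonneg_of_pos (mul_nonneg (sub_nonneg.2 hN') hs) hpos

lemma fracDiv_single (s : ℝ) (i : Fin N) (w : (Fin N → ℝ) → ℝ) (x : Fin N → ℝ) :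
    fracDiv s (fun y => Pi.single i (w y)) x = divConst N s * rlPartialRight s i w x := by
  rw [fracDiv, divConst, Finset.sum_eq_single i (fun j _ hj => ?_) (by simp)]
  · simp only [Pi.single_eq_same]
  · simp only [Pi.single_eq_of_ne hj, rlPartialRight_zero]

lemma dualNorm_single_le {p : ℝ≥0∞} (hp : 1 ≤ p) (i : Fin N) (c : ℝ) :
    dualNorm p (Pi.single i c) ≤ |c| := by
  have : Fact (1 ≤ p) := ⟨hp⟩
  refine Real.sSup_le ?_ (abs_nonneg c)
  rintro t ⟨x, hx, rfl⟩
  rw [Finset.sum_eq_single i (fun j _ hj => by simp [hj]) (by simp), Pi.single_eq_same]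
  refine (le_abs_self _).trans ((abs_mul _ _).trans_le ?_)
  exact mul_le_of_le_one_left (abs_nonneg c)
    ((PiLp.norm_apply_le (WithLp.toLp p x) i).trans hx)

lemma isTestField_single {p : ℝ≥0∞} (hp : 1 ≤ p) (i : Fin N) {w : (Fin N → ℝ) → ℝ}
    (hw : ContDiff ℝ ∞ w) (hc : HasCompactSupport w) (hsub : tsupport w ⊆ cube N)
    (hle : ∀ x, |w x| ≤ 1) : IsTestField p fun x => (Pi.single i (w x) : Fin N → ℝ) where
  smooth := (ContinuousLinearMap.single ℝ (fun _ : Fin N => ℝ) i).contDiff.comp hw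
  compactSupport := hc.comp_left (g := fun c => (Pi.single i c : Fin N → ℝ)) (Pi.single_zero i)
  support_subset :=
    (tsupport_comp_subset (g := fun c => (Pi.single i c : Fin N → ℝ)) (Pi.single_zero i) w).trans
      hsub
  dualNorm_le x := (dualNorm_single_le hp i (w x)).trans (hle x)

lemma integral_mul_fracDiv_le {s : ℝ} {p : ℝ≥0∞} {u : (Fin N → ℝ) → ℝ}
    (hu : fracTV s p u < ⊤) {φ : (Fin N → ℝ) → (Fin N → ℝ)} (hφ : IsTestField p φ) :
    ∫ x in cube N, u x * fracDiv s φ x ≤ (fracTV s p u).toReal := by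
  rw [← ENNReal.ofReal_le_iff_le_toReal hu.ne]
  exact le_iSup₂ (f := fun φ (_ : IsTestField p φ) =>
    ENNReal.ofReal (∫ x in cube N, u x * fracDiv s φ x)) φ hφ

/-! ### The duality estimate -/

section Duality

variable {s : ℝ} {p : ℝ≥0∞} {u w : (Fin N → ℝ) → ℝ}

lemma neg_integral_mul_partialFracIntegral_le (hN : 1 ≤ N) (hs : s ∈ Ioo (0 : ℝ) 1) (hp : 1 ≤ p)
    (hu : fracTV s p u < ⊤) (i : Fin N) (hw : ContDiff ℝ ∞ w) (hc : HasCompactSupport w)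
    (hsub : tsupport w ⊆ cube N) (hle : ∀ x, |w x| ≤ 1) :
    -∫ x in cube N, u x * partialFracIntegral (1 - s) i (partialDeriv i w) x
      ≤ Real.Gamma (1 - s) / divConst N s * (fracTV s p u).toReal := by
  have hΓ : 0 < Real.Gamma (1 - s) := Real.Gamma_pos_of_pos (sub_pos.2 hs.2)
  have hd : 0 < divConst N s := divConst_pos hN hs.1.le
  have htest := integral_mul_fracDiv_le hu (isTestField_single hp i hw hc hsub hle)
  have hdiv : ∫ x in cube N, u x * fracDiv s (fun y => Pi.single i (w y)) x
      = divConst N s / Real.Gamma (1 - s) *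
        -∫ x in cube N, u x * partialFracIntegral (1 - s) i (partialDeriv i w) x := by
    rw [← integral_neg, ← integral_const_mul]
    refine setIntegral_congr_fun measurableSet_cube fun x hx => ?_
    rw [fracDiv_single, rlPartialRight_eq hs.2 i (hw.of_le (by simp))
      (fun _ => eq_zero_of_tsupport_subset_cube hsub) (hx i (mem_univ i))]
    ring
  rw [hdiv, ← le_div_iff₀' (by positivity)] at htest
  exact htest.trans_eq (by field_simp)

lemma partialFracIntegral_partialDeriv_const_mul (a : ℝ) (i : Fin N) (hw : Differentiable ℝ w)
    (c : ℝ) (x : Fin N → ℝ) :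
    partialFracIntegral a i (partialDeriv i fun x => c * w x) x
      = c * partialFracIntegral a i (partialDeriv i w) x := by
  have hderiv : (partialDeriv i fun x => c * w x) = fun x => c * partialDeriv i w x := by
    ext x
    rw [partialDeriv, fderiv_const_mul (hw x)]
    rfl
  rw [hderiv, partialFracIntegral, fracIntegral_const_mul, partialFracIntegral]

lemma abs_integral_mul_partialFracIntegral_le (hN : 1 ≤ N) (hs : s ∈ Ioo (0 : ℝ) 1)
    (hp : 1 ≤ p) (hu : fracTV s p u < ⊤) (i : Fin N) (hw : ContDiff ℝ ∞ w)
    (hc : HasCompactSupport w) (hsub : tsupport w ⊆ cube N) {b : ℝ} (hb : ∀ x, |w x| ≤ b) :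
    |∫ x in cube N, u x * partialFracIntegral (1 - s) i (partialDeriv i w) x|
      ≤ Real.Gamma (1 - s) / divConst N s * b * (fracTV s p u).toReal := by
  rcases ((abs_nonneg _).trans (hb 0)).eq_or_lt with rfl | hb₀
  · obtain rfl : w = fun _ => 0 := funext fun x => abs_nonpos_iff.1 (hb x)
    simp [partialFracIntegral, partialDeriv, fracIntegral]
  have hscale (c : ℝ) (hc' : |c| = b⁻¹) :
      -(c * ∫ x in cube N, u x * partialFracIntegral (1 - s) i (partialDeriv i w) x)
        ≤ Real.Gamma (1 - s) / divConst N s * (fracTV s p u).toReal := by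
    have h := neg_integral_mul_partialFracIntegral_le hN hs hp hu i (w := fun x => c * w x)
      (contDiff_const.mul hw) hc.mul_left
      ((tsupport_mul_subset_right (f := fun _ => c)).trans hsub) fun x => by
        rw [abs_mul, hc', inv_mul_le_one₀ hb₀]
        exact hb x
    simpa only [partialFracIntegral_partialDeriv_const_mul _ i (hw.differentiable (by simp)),
      mul_left_comm (u _) c, integral_const_mul] using h
  have hpos := hscale b⁻¹ (abs_of_pos (inv_pos.2 hb₀))
  have hneg := hscale (-b⁻¹) (by rw [abs_neg, abs_of_pos (inv_pos.2 hb₀)])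
  rw [mul_right_comm, ← inv_mul_le_iff₀' hb₀, ← abs_of_pos (inv_pos.2 hb₀), ← abs_mul]
  exact abs_le.2 ⟨by linarith, by linarith⟩

lemma integrableOn_mul_of_continuous (hu : IntegrableOn u (cube N)) (hw : Continuous w) :
    IntegrableOn (fun x => u x * w x) (cube N) := by
  obtain ⟨C, hC⟩ := (isCompact_Icc (a := (0 : Fin N → ℝ)) (b := 1)).exists_bound_of_continuousOn
    hw.continuousOn
  refine hu.mul_bdd (c := C) hw.aestronglyMeasurable ?_
  filter_upwards [ae_restrict_mem measurableSet_cube] with x hx using hC x (cube_subset_Icc hx)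

lemma abs_integral_mul_le_mul_normL1 (hu : IntegrableOn u (cube N)) {E : ℝ}
    (hw : ∀ x ∈ cube N, |w x| ≤ E) :
    |∫ x in cube N, u x * w x| ≤ E * (normL1 u).toReal := by
  rw [normL1, eLpNorm_one_eq_lintegral_enorm, ← integral_norm_eq_lintegral_enorm hu.1,
    ← integral_const_mul]
  refine norm_integral_le_of_norm_le (f := fun x => u x * w x) (hu.norm.const_mul E) ?_
  filter_upwards [ae_restrict_mem measurableSet_cube] with x hx
  rw [norm_mul, mul_comm]
  exact mul_le_mul_of_nonneg_right (hw x hx) (norm_nonneg _)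

lemma mul_abs_integral_mul_le (hN : 1 ≤ N) (hs : s ∈ Ioo (0 : ℝ) 1) (hp : 1 ≤ p)
    (hu : IntegrableOn u (cube N)) (hTV : fracTV s p u < ⊤) (i : Fin N) (hw : ContDiff ℝ ∞ w)
    (hc : HasCompactSupport w) (hsub : tsupport w ⊆ cube N) {b : ℝ} (hb : ∀ x, |w x| ≤ b)
    {f : (Fin N → ℝ) → ℝ} (hf : Continuous f) {β E : ℝ} (hβ : 0 ≤ β)
    (hE : ∀ x ∈ cube N, |partialFracIntegral (1 - s) i (partialDeriv i w) x + β * f x| ≤ E) :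
    β * |∫ x in cube N, u x * f x|
      ≤ Real.Gamma (1 - s) / divConst N s * b * (fracTV s p u).toReal
        + E * (normL1 u).toReal := by
  have hs' : 0 < 1 - s := sub_pos.2 hs.2
  set g := partialFracIntegral (1 - s) i (partialDeriv i w)
  have hg : Continuous g :=
    continuous_partialFracIntegral hs' i (continuous_partialDeriv (hw.of_le (by simp)) i)
  have hgf : Continuous fun x => g x + β * f x := hg.add (continuous_const.mul hf)
  have hsplit : β * ∫ x in cube N, u x * f x
      = (∫ x in cube N, u x * (g x + β * f x)) - ∫ x in cube N, u x * g x := by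
    rw [← integral_const_mul, ← integral_sub (integrableOn_mul_of_continuous hu hgf)
      (integrableOn_mul_of_continuous hu hg)]
    congr 1 with x
    ring
  calc β * |∫ x in cube N, u x * f x|
      = |(∫ x in cube N, u x * (g x + β * f x)) - ∫ x in cube N, u x * g x| := by
        rw [← hsplit, abs_mul, abs_of_nonneg hβ]
    _ ≤ |∫ x in cube N, u x * (g x + β * f x)| + |∫ x in cube N, u x * g x| := abs_sub _ _
    _ ≤ _ := by
        rw [add_comm]
        exact add_le_add
          (abs_integral_mul_partialFracIntegral_le hN hs hp hTV i hw hc hsub hb)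
          (abs_integral_mul_le_mul_normL1 hu hE)

lemma exists_abs_partialFracIntegral_partialDeriv_add_le (hs : s ∈ Ioo (0 : ℝ) 1) :
    ∃ C M, 0 ≤ C ∧ ∀ {i : Fin N} {f : (Fin N → ℝ) → ℝ} {δ L ε : ℝ}, ContDiff ℝ ∞ f →
      HasCompactSupport f → tsupport f ⊆ cube N → (∀ x, |partialFracIntegral s i f x| ≤ δ) →
      (∀ x ∈ Icc 0 1, |partialDeriv i (correctedFracIntegral s i f) x| ≤ L) →
      0 < ε → 2 * ε ≤ 1 → ∀ x ∈ cube N,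
      |partialFracIntegral (1 - s) i
            (partialDeriv i fun x => cutoff ε (x i) * correctedFracIntegral s i f x) x
          + ProbabilityTheory.beta (1 - s) s * f x|
        ≤ C * δ + M * L * ∫ r in (0 : ℝ)..(2 * ε), fracKernel (1 - s) r := by
  obtain ⟨C, M, hC, h⟩ := exists_abs_fracIntegral_deriv_cutoff_mul_add_le hs
  refine ⟨C, M, hC, fun {i f δ L ε} hf hc hsub hδ hL hε hε' x hx => ?_⟩
  have hV : ContDiff ℝ ∞ (correctedFracIntegral s i f) :=
    contDiff_correctedFracIntegral hs.1 i hf hc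
  have hw : ContDiff ℝ ∞ fun x => cutoff ε (x i) * correctedFracIntegral s i f x :=
    ((contDiff_cutoff ε).comp (contDiff_apply ℝ ℝ i)).mul hV
  have hline₀ (t : ℝ) (ht : 1 ≤ t) : f (Function.update x i t) = 0 :=
    eq_zero_of_tsupport_subset_cube hsub (by rwa [Function.update_self])
  have hlineL (t : ℝ) (ht : t ∈ Icc (0 : ℝ) 1) :
      |deriv (vanishAtZero (fracIntegral s fun t => f (Function.update x i t))) t| ≤ L := by
    rw [← funext fun t => correctedFracIntegral_update s i f x t,
      deriv_comp_update (hV.differentiable (by simp))]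
    have hx' := cube_subset_Icc hx
    exact hL _ ⟨le_update_iff.2 ⟨ht.1, fun j _ => hx'.1 j⟩,
      update_le_iff.2 ⟨ht.2, fun j _ => hx'.2 j⟩⟩
  have hline := h ((contDiff_comp_update hf i x).of_le (by simp)) hline₀ hlineL hε hε'
    (Ioo_subset_Icc_self (hx i (mem_univ i)))
  rw [partialFracIntegral_partialDeriv _ i (hw.differentiable (by simp))]
  simp only [correctedFracIntegral_update, Function.update_self]
  rw [Function.update_eq_self] at hline
  refine hline.trans (add_le_add_left (mul_le_mul_of_nonneg_left ?_ hC) _)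
  rw [← partialFracIntegral_update]
  exact hδ _

lemma le_of_forall_le_add_intervalIntegral_fracKernel {a b c d m y : ℝ} (ha : 0 < a)
    (h : ∀ ε, 0 < ε → 2 * ε ≤ 1 →
      y ≤ b + (c + d * ∫ r in (0 : ℝ)..(2 * ε), fracKernel a r) * m) :
    y ≤ b + c * m := by
  have htwo : Tendsto (fun ε : ℝ => 2 * ε) (𝓝[>] 0) (𝓝 0) :=
    ((continuous_const_mul 2).tendsto' 0 0 (mul_zero 2)).mono_left nhdsWithin_le_nhds
  have hkernel : Tendsto (fun ε => ∫ r in (0 : ℝ)..(2 * ε), fracKernel a r) (𝓝[>] 0) (𝓝 0) :=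
    (tendsto_intervalIntegral_fracKernel ha).comp htwo
  have hlimit : Tendsto (fun ε => b + (c + d * ∫ r in (0 : ℝ)..(2 * ε), fracKernel a r) * m)
      (𝓝[>] 0) (𝓝 (b + c * m)) := by
    simpa only [mul_zero, add_zero] using
      (((hkernel.const_mul d).const_add c).mul_const m).const_add b
  refine ge_of_tendsto hlimit ?_
  filter_upwards [Ioc_mem_nhdsGT (show (0 : ℝ) < 1 / 2 by norm_num)] with ε hε
  exact h ε hε.1 (by linarith [hε.2])

theorem exists_abs_integral_mul_le (hN : 1 ≤ N) (hs : s ∈ Ioo (0 : ℝ) 1) :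
    ∃ A, 0 ≤ A ∧ ∀ {p : ℝ≥0∞} {u f : (Fin N → ℝ) → ℝ} {i : Fin N} {δ : ℝ}, 1 ≤ p →
      IntegrableOn u (cube N) → fracTV s p u < ⊤ → ContDiff ℝ ∞ f → HasCompactSupport f →
      tsupport f ⊆ cube N → (∀ x, |partialFracIntegral s i f x| ≤ δ) →
      |∫ x in cube N, u x * f x| ≤ A * δ * (fracBVNorm s p u).toReal := by
  have hs' : 0 < 1 - s := sub_pos.2 hs.2
  have hβ : 0 < ProbabilityTheory.beta (1 - s) s := ProbabilityTheory.beta_pos hs' hs.1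
  obtain ⟨C, M, hC, hpointwise⟩ := exists_abs_partialFracIntegral_partialDeriv_add_le (N := N) hs
  set D := Real.Gamma (1 - s) / divConst N s * 2
  set β := ProbabilityTheory.beta (1 - s) s
  have hD : 0 ≤ D := mul_nonneg
    (div_nonneg (Real.Gamma_pos_of_pos hs').le (divConst_pos hN hs.1.le).le) zero_le_two
  refine ⟨(D + C) / β, div_nonneg (add_nonneg hD hC) hβ.le, ?_⟩
  intro p u f i δ hp hu hTV hf hc hsub hδ
  obtain ⟨α, hα, hbox⟩ := exists_boxSupported hc hsub
  have hV : ContDiff ℝ ∞ (correctedFracIntegral s i f) :=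
    contDiff_correctedFracIntegral hs.1 i hf hc
  obtain ⟨L, hL⟩ := (isCompact_Icc (a := (0 : Fin N → ℝ)) (b := 1)).exists_bound_of_continuousOn
    (continuous_partialDeriv (hV.of_le (by simp)) i).continuousOn
  have hcutoff (ε : ℝ) (hε : 0 < ε) (hε' : 2 * ε ≤ 1) : β * |∫ x in cube N, u x * f x|
      ≤ D * δ * (fracTV s p u).toReal
        + (C * δ + M * L * ∫ r in (0 : ℝ)..(2 * ε), fracKernel (1 - s) r)
          * (normL1 u).toReal := by
    have hw := hbox.cutoff_mul_correctedFracIntegral (s := s) (i := i) hε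
    refine (mul_abs_integral_mul_le hN hs hp hu hTV i
      (((contDiff_cutoff ε).comp (contDiff_apply ℝ ℝ i)).mul hV) hw.hasCompactSupport
      (hw.tsupport_subset_cube (lt_min hε hα)) (b := 2 * δ) (fun x => ?_) hf.continuous hβ.le
      (hpointwise hf hc hsub hδ hL hε hε')).trans_eq (by ring)
    rw [Function.comp_apply, abs_mul, abs_of_nonneg (cutoff_nonneg ε _)]
    exact (mul_le_of_le_one_left (abs_nonneg _) (cutoff_le_one ε _)).trans
      (abs_correctedFracIntegral_le hδ x)
  have hbound := le_of_forall_le_add_intervalIntegral_fracKernel hs' hcutoff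
  have hδ₀ : 0 ≤ δ := (abs_nonneg _).trans (hδ 0)
  have hL1 : normL1 u ≠ ⊤ := (memLp_one_iff_integrable.2 hu).2.ne
  rw [fracBVNorm, ENNReal.toReal_add hL1 hTV.ne,
    div_mul_eq_mul_div, div_mul_eq_mul_div, le_div_iff₀' hβ]
  have hcross₁ : 0 ≤ D * δ * (normL1 u).toReal :=
    mul_nonneg (mul_nonneg hD hδ₀) ENNReal.toReal_nonneg
  have hcross₂ : 0 ≤ C * δ * (fracTV s p u).toReal := by positivity
  linarith

end Duality

/-! ### Translation estimates in `L¹` -/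

section L1Duality

lemma tendsto_mul_div_sqrt {b : ℕ → ℝ} {a : ℝ} (hb : Tendsto b atTop (𝓝 a)) :
    Tendsto (fun n : ℕ => a * (b n / √(b n ^ 2 + (1 / ((n : ℝ) + 1)) ^ 2))) atTop (𝓝 |a|) := by
  rcases eq_or_ne a 0 with rfl | ha
  · simp
  have hlim : Tendsto (fun n : ℕ => a * (b n / √(b n ^ 2 + (1 / ((n : ℝ) + 1)) ^ 2))) atTop
      (𝓝 (a * (a / √(a ^ 2 + 0 ^ 2)))) :=
    (hb.div ((hb.pow 2).add (tendsto_one_div_add_atTop_nhds_zero_nat.pow 2)).sqrt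
      (by simpa [Real.sqrt_sq_eq_abs] using ha)).const_mul a
  have habs : a * (a / √(a ^ 2 + 0 ^ 2)) = |a| := by
    rw [zero_pow two_ne_zero, add_zero, Real.sqrt_sq_eq_abs, ← mul_div_assoc,
      div_eq_iff (abs_ne_zero.2 ha), abs_mul_abs_self]
  rwa [habs] at hlim

lemma abs_div_sqrt_le_one (y δ : ℝ) : |y / √(y ^ 2 + δ ^ 2)| ≤ 1 := by
  rw [abs_div, abs_of_nonneg (Real.sqrt_nonneg _)]
  exact div_le_one_of_le₀ (Real.abs_le_sqrt (le_add_of_nonneg_right (sq_nonneg δ)))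
    (Real.sqrt_nonneg _)

variable {E : Type*} [NormedAddCommGroup E] [NormedSpace ℝ E] [FiniteDimensional ℝ E]

lemma exists_contDiff_eq_one_tsupport_subset {U K : Set E} (hU : IsOpen U) (hK : IsCompact K)
    (hKU : K ⊆ U) :
    ∃ χ : E → ℝ, ContDiff ℝ ∞ χ ∧ HasCompactSupport χ ∧ tsupport χ ⊆ U ∧
      (∀ x, χ x ∈ Icc (0 : ℝ) 1) ∧ ∀ x ∈ K, χ x = 1 := by
  obtain ⟨V, hV, hKV, hVU, hVc⟩ := exists_open_between_and_isCompact_closure hK hU hKU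
  obtain ⟨χ, hχ, hrange, hsupp, hone⟩ := exists_contMDiff_support_eq_eq_one_iff (n := ⊤)
    (modelWithCornersSelf ℝ E) hV hK.isClosed hKV
  have htsupp : tsupport χ = closure V := by rw [tsupport, hsupp]
  refine ⟨χ, contMDiff_iff_contDiff.1 hχ, ?_, htsupp ▸ hVU, fun x => hrange (mem_range_self x),
    fun x hx => (hone x).1 hx⟩
  rwa [HasCompactSupport, htsupp]

variable [MeasurableSpace E] [BorelSpace E] {μ : Measure E}

lemma exists_seq_contDiff_tendsto_mul_abs [IsFiniteMeasureOnCompacts μ] {f : E → ℝ}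
    (hf : Integrable f μ) :
    ∃ σ : ℕ → E → ℝ, (∀ n, ContDiff ℝ ∞ (σ n)) ∧ (∀ n x, |σ n x| ≤ 1) ∧
      ∀ᵐ x ∂μ, Tendsto (fun n => f x * σ n x) atTop (𝓝 |f x|) := by
  choose g _ hg hgε using fun n : ℕ => (memLp_one_iff_integrable.2 hf).exist_eLpNorm_sub_le
    ENNReal.one_ne_top le_rfl (Nat.one_div_pos_of_nat (α := ℝ) (n := n))
  have hL1 : Tendsto (fun n => eLpNorm (g n - f) 1 μ) atTop (𝓝 0) := by
    refine tendsto_of_tendsto_of_tendsto_of_le_of_le tendsto_const_nhds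
      (ENNReal.tendsto_ofReal tendsto_one_div_add_atTop_nhds_zero_nat |>.trans (by simp))
      (fun _ => zero_le) fun n => ?_
    rw [eLpNorm_sub_comm]
    exact hgε n
  obtain ⟨k, _, hk⟩ := (tendstoInMeasure_of_tendsto_eLpNorm one_ne_zero
    (fun n => (hg n).continuous.aestronglyMeasurable) hf.1 hL1).exists_seq_tendsto_ae
  refine ⟨fun n x => g (k n) x / √(g (k n) x ^ 2 + (1 / ((n : ℝ) + 1)) ^ 2), fun n => ?_,
    fun n x => abs_div_sqrt_le_one _ _, ?_⟩
  · have hpos (x : E) : g (k n) x ^ 2 + (1 / ((n : ℝ) + 1)) ^ 2 ≠ 0 := by positivity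
    exact (hg _).div ((((hg _).pow 2).add contDiff_const).sqrt hpos) fun x => by positivity
  · filter_upwards [hk] with x hx using tendsto_mul_div_sqrt hx

lemma integral_abs_mul_le_of_forall_integral_mul_le [IsLocallyFiniteMeasure μ] {U : Set E}
    {f : E → ℝ} (hf : IntegrableOn f U μ) {M : ℝ}
    (hM : ∀ ψ : E → ℝ, ContDiff ℝ ∞ ψ → HasCompactSupport ψ → tsupport ψ ⊆ U →
      (∀ x, |ψ x| ≤ 1) → ∫ x in U, f x * ψ x ∂μ ≤ M)
    {χ : E → ℝ} (hχ : ContDiff ℝ ∞ χ) (hχc : HasCompactSupport χ) (hχU : tsupport χ ⊆ U)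
    (hχ₁ : ∀ x, |χ x| ≤ 1) : ∫ x in U, |f x| * χ x ∂μ ≤ M := by
  obtain ⟨σ, hσ, hσ₁, hlim⟩ := exists_seq_contDiff_tendsto_mul_abs hf
  have hψ₁ (n : ℕ) (x : E) : |χ x * σ n x| ≤ 1 := by
    rw [abs_mul]
    exact mul_le_one₀ (hχ₁ x) (abs_nonneg _) (hσ₁ n x)
  have htendsto : Tendsto (fun n => ∫ x in U, f x * (χ x * σ n x) ∂μ) atTop
      (𝓝 (∫ x in U, |f x| * χ x ∂μ)) := by
    refine tendsto_integral_of_dominated_convergence (fun x => ‖f x‖)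
      (fun n => hf.1.mul (hχ.mul (hσ n)).continuous.aestronglyMeasurable) hf.norm
      (fun n => ae_of_all _ fun x => ?_) ?_
    · rw [norm_mul]
      exact mul_le_of_le_one_right (norm_nonneg _) (hψ₁ n x)
    · filter_upwards [hlim] with x hx
      exact (hx.mul_const (χ x)).congr fun n => by ring
  exact le_of_tendsto' htendsto fun n =>
    hM _ (hχ.mul (hσ n)) hχc.mul_right (tsupport_mul_subset_left.trans hχU) (hψ₁ n)

theorem lintegral_enorm_le_of_forall_integral_mul_le [IsLocallyFiniteMeasure μ] {U : Set E}
    (hU : IsOpen U) {f : E → ℝ} (hf : IntegrableOn f U μ) {M : ℝ}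
    (hM : ∀ ψ : E → ℝ, ContDiff ℝ ∞ ψ → HasCompactSupport ψ → tsupport ψ ⊆ U →
      (∀ x, |ψ x| ≤ 1) → ∫ x in U, f x * ψ x ∂μ ≤ M) :
    ∫⁻ x in U, ‖f x‖ₑ ∂μ ≤ ENNReal.ofReal M := by
  set ν : Measure E := (μ.restrict U).withDensity fun x => ‖f x‖ₑ
  have hν : IsFiniteMeasure ν := isFiniteMeasure_withDensity hf.2.ne
  have hνU : ν U = ∫⁻ x in U, ‖f x‖ₑ ∂μ := by
    rw [withDensity_apply _ hU.measurableSet, Measure.restrict_restrict hU.measurableSet,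
      inter_self]
  rw [← hνU, hU.measure_eq_iSup_isCompact]
  refine iSup₂_le fun K hKU => iSup_le fun hK => ?_
  obtain ⟨χ, hχ, hχc, hχU, hχ₀₁, hχK⟩ := exists_contDiff_eq_one_tsupport_subset hU hK hKU
  have hχ₁ (x : E) : |χ x| ≤ 1 := (abs_of_nonneg (hχ₀₁ x).1).trans_le (hχ₀₁ x).2
  have hint : Integrable (fun x => |f x| * χ x) (μ.restrict U) :=
    hf.abs.mul_bdd (c := 1) hχ.continuous.aestronglyMeasurable (ae_of_all _ hχ₁)
  calc ν K = ∫⁻ x in K, ‖f x‖ₑ ∂μ.restrict U := withDensity_apply _ hK.measurableSet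
    _ = ∫⁻ x in K, ‖|f x| * χ x‖ₑ ∂μ.restrict U :=
        setLIntegral_congr_fun hK.measurableSet fun x hx => by simp [hχK x hx]
    _ ≤ ∫⁻ x in U, ‖|f x| * χ x‖ₑ ∂μ := setLIntegral_le_lintegral _ _
    _ = ENNReal.ofReal (∫ x in U, |f x| * χ x ∂μ) := by
        rw [← ofReal_integral_norm_eq_lintegral_enorm hint]
        congr 2 with x
        exact Real.norm_of_nonneg (mul_nonneg (abs_nonneg _) (hχ₀₁ x).1)
    _ ≤ ENNReal.ofReal M := ENNReal.ofReal_le_ofReal <|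
        integral_abs_mul_le_of_forall_integral_mul_le hf hM hχ hχc hχU hχ₁

end L1Duality

section Translation

/-- The part of `U` that stays in `U` under translation by `h`; increments `u (x + h) - u x` of a
function `u` on `U` only make sense there. -/
def overlap {G : Type*} [Add G] (U : Set G) (h : G) : Set G := {x | x ∈ U ∧ x + h ∈ U}

variable {G : Type*} [AddCommGroup G] [TopologicalSpace G] [IsTopologicalAddGroup G]

lemma isOpen_overlap {U : Set G} (hU : IsOpen U) (h : G) : IsOpen (overlap U h) :=
  hU.inter (hU.preimage (continuous_id.add continuous_const))

variable [MeasurableSpace G] [BorelSpace G] {μ : Measure G} [μ.IsAddLeftInvariant]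

lemma tendsto_integral_norm_add_sub [LocallyCompactSpace G] [IsLocallyFiniteMeasure μ]
    [μ.InnerRegularCompactLTTop] {F : Type*} [NormedAddCommGroup F] {f : G → F}
    (hf : Integrable f μ) :
    Tendsto (fun h => ∫ x, ‖f (x + h) - f x‖ ∂μ) (𝓝 0) (𝓝 0) := by
  have hf' := memLp_one_iff_integrable.2 hf
  have : Fact ((1 : ℝ≥0∞) ≠ ⊤) := ⟨ENNReal.one_ne_top⟩
  have hmk : Tendsto (fun h : G => DomAddAct.mk h +ᵥ hf'.toLp f) (𝓝 0) (𝓝 (hf'.toLp f)) :=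
    (DomAddAct.continuous_mk.vadd continuous_const).tendsto' _ _ (by simp)
  refine (tendsto_iff_dist_tendsto_zero.1 hmk).congr fun h => ?_
  rw [DomAddAct.mk_vadd_toLp, dist_eq_norm, ← MemLp.toLp_sub, Lp.norm_toLp,
    eLpNorm_one_eq_lintegral_enorm, ← integral_norm_eq_lintegral_enorm]
  · simp [add_comm]
  · exact ((hf.comp_add_left h).sub hf).1

lemma integrableOn_comp_add_right {F : Type*} [NormedAddCommGroup F] {U : Set G} (hU : IsOpen U)
    {u : G → F} (hu : IntegrableOn u U μ) (h : G) :
    IntegrableOn (fun x => u (x + h)) (overlap U h) μ :=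
  ((hu.integrable_indicator hU.measurableSet).comp_add_right h).integrableOn.congr_fun
    (fun _ hx => indicator_of_mem hx.2 u) (isOpen_overlap hU h).measurableSet

lemma setIntegral_add_sub_mul {U : Set G} (hU : IsOpen U) {u ψ : G → ℝ}
    (hu : IntegrableOn u U μ) (h : G) (hψ : Continuous ψ) (hsub : tsupport ψ ⊆ overlap U h)
    {C : ℝ} (hψC : ∀ x, |ψ x| ≤ C) :
    ∫ x in overlap U h, (u (x + h) - u x) * ψ x ∂μ = ∫ x in U, u x * (ψ (x - h) - ψ x) ∂μ := by
  set w : G → ℝ := U.indicator u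
  have hw : Integrable w μ := hu.integrable_indicator hU.measurableSet
  have hbdd {v η : G → ℝ} (hv : Integrable v μ) (hη : Continuous η) (hηC : ∀ x, |η x| ≤ C) :
      Integrable (fun x => v x * η x) μ :=
    hv.mul_bdd hη.aestronglyMeasurable (ae_of_all _ hηC)
  have hψ₀ (x : G) (hx : x ∉ overlap U h) : ψ x = 0 :=
    image_eq_zero_of_notMem_tsupport fun hx' => hx (hsub hx')
  have hshift : ∫ x, w (x + h) * ψ x ∂μ = ∫ x, w x * ψ (x - h) ∂μ := by
    rw [← integral_add_right_eq_self (fun x => w x * ψ (x - h)) h]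
    simp only [add_sub_cancel_right]
  have i₁ := hbdd (hw.comp_add_right h) hψ hψC
  have i₂ := hbdd hw (hψ.comp (continuous_sub_right h)) fun x => hψC _
  have i₃ := hbdd hw hψ hψC
  calc ∫ x in overlap U h, (u (x + h) - u x) * ψ x ∂μ
      = ∫ x, (w (x + h) * ψ x - w x * ψ x) ∂μ := by
        rw [← integral_indicator (isOpen_overlap hU h).measurableSet]
        congr 1 with x
        by_cases hx : x ∈ overlap U h
        · simp only [indicator_of_mem hx, w, indicator_of_mem hx.1, indicator_of_mem hx.2, sub_mul]
        · simp [hx, hψ₀ x hx]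
    _ = ∫ x, (w x * ψ (x - h) - w x * ψ x) ∂μ := by
        rw [integral_sub i₁ i₃, hshift]
        exact (integral_sub i₂ i₃).symm
    _ = ∫ x in U, u x * (ψ (x - h) - ψ x) ∂μ := by
        rw [← integral_indicator hU.measurableSet]
        congr 1 with x
        by_cases hx : x ∈ U <;> simp [w, hx, mul_sub]

end Translation

section TranslationEstimate

/-- The `L¹` modulus of continuity of the truncated kernel, which controls the increments of
functions of bounded fractional variation. -/
def kernelModulus (a h : ℝ) : ℝ := ∫ r, ‖fracKernel a (r + h) - fracKernel a r‖

lemma tendsto_kernelModulus {a : ℝ} (ha : 0 < a) : Tendsto (kernelModulus a) (𝓝 0) (𝓝 0) :=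
  tendsto_integral_norm_add_sub (integrable_fracKernel ha)

lemma abs_fracIntegral_comp_sub_sub_le {a : ℝ} (ha : 0 < a) {v : ℝ → ℝ} (hv : Continuous v)
    (hv₁ : ∀ t, |v t| ≤ 1) (h y : ℝ) :
    |fracIntegral a (fun t => v (t - h) - v t) y| ≤ kernelModulus a h := by
  have hk := integrable_fracKernel ha
  have hkv : Integrable fun r => fracKernel a r * v (y + r) :=
    integrable_fracKernel_mul ha (by fun_prop)
  have hkvh : Integrable fun r => fracKernel a r * v (y + r - h) :=
    integrable_fracKernel_mul ha (by fun_prop)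
  have hkhv : Integrable fun r => fracKernel a (r + h) * v (y + r) := by
    simpa only [← add_assoc, add_sub_cancel_right] using hkvh.comp_add_right h
  have hshift : ∫ r, fracKernel a (r + h) * v (y + r) = ∫ r, fracKernel a r * v (y + r - h) := by
    rw [← integral_add_right_eq_self (fun r => fracKernel a r * v (y + r - h)) h]
    simp only [← add_assoc, add_sub_cancel_right]
  have hmove : fracIntegral a (fun t => v (t - h) - v t) y
      = ∫ r, (fracKernel a (r + h) - fracKernel a r) * v (y + r) := by
    simp only [fracIntegral, mul_sub, sub_mul]
    rw [integral_sub hkvh hkv, integral_sub hkhv hkv, hshift]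
  have hdiff : Integrable fun r => fracKernel a (r + h) - fracKernel a r :=
    (hk.comp_add_right h).sub hk
  rw [hmove, kernelModulus]
  exact norm_integral_le_of_norm_le hdiff.norm <| ae_of_all _ fun r =>
    (norm_mul _ _).trans_le (mul_le_of_le_one_right (norm_nonneg _) (hv₁ _))

lemma abs_partialFracIntegral_comp_sub_sub_le {a : ℝ} (ha : 0 < a) (i : Fin N) (h : ℝ)
    {ψ : (Fin N → ℝ) → ℝ} (hψ : Continuous ψ) (hψ₁ : ∀ x, |ψ x| ≤ 1) (x : Fin N → ℝ) :
    |partialFracIntegral a i (fun y => ψ (y - Pi.single i h) - ψ y) x| ≤ kernelModulus a h := by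
  have hline (t : ℝ) :
      Function.update x i t - Pi.single i h = Function.update x i (t - h) := by
    ext j
    rcases eq_or_ne j i with rfl | hj
    · simp
    · simp [hj]
  simp only [partialFracIntegral, hline]
  exact abs_fracIntegral_comp_sub_sub_le ha (hψ.comp (continuous_const.update i continuous_id))
    (fun _ => hψ₁ _) h (x i)

/-- The `L¹` size of the increment of `u` under translation by `h` inside `U`. -/
def translationIncrement {G : Type*} [Add G] [MeasurableSpace G] (μ : Measure G) (U : Set G)
    (u : G → ℝ) (h : G) : ℝ≥0∞ :=
  ∫⁻ x in overlap U h, ‖u (x + h) - u x‖ₑ ∂μ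

theorem exists_translationIncrement_single_le (hN : 1 ≤ N) {s : ℝ} (hs : s ∈ Ioo (0 : ℝ) 1) :
    ∃ A, 0 ≤ A ∧ ∀ {p : ℝ≥0∞} {u : (Fin N → ℝ) → ℝ}, 1 ≤ p → IntegrableOn u (cube N) →
      fracTV s p u < ⊤ → ∀ (i : Fin N) (h : ℝ),
      translationIncrement volume (cube N) u (Pi.single i h)
        ≤ ENNReal.ofReal (A * kernelModulus s h * (fracBVNorm s p u).toReal) := by
  obtain ⟨A, hA, hdual⟩ := exists_abs_integral_mul_le hN hs
  refine ⟨A, hA, fun {p u} hp hu hTV i h => ?_⟩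
  set e : Fin N → ℝ := Pi.single i h
  refine lintegral_enorm_le_of_forall_integral_mul_le (f := fun x => u (x + e) - u x)
    (isOpen_overlap isOpen_cube e)
    ((integrableOn_comp_add_right isOpen_cube hu e).sub (hu.mono_set fun x hx => hx.1))
    fun ψ hψ hψc hψsub hψ₁ => ?_
  have hshift : tsupport (fun x => ψ (x - e)) ⊆ cube N := fun x hx => by
    have hx' : x - e ∈ tsupport ψ := tsupport_comp_subset_preimage ψ (continuous_sub_right e) hx
    simpa only [sub_add_cancel] using (hψsub hx').2
  rw [setIntegral_add_sub_mul isOpen_cube hu e hψ.continuous hψsub hψ₁]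
  exact (le_abs_self _).trans <| hdual hp hu hTV
    ((hψ.comp (contDiff_id.sub contDiff_const)).sub hψ)
    ((hψc.comp_homeomorph (Homeomorph.subRight e)).sub hψc)
    ((tsupport_sub _ _).trans (union_subset hshift (hψsub.trans fun x hx => hx.1)))
    (abs_partialFracIntegral_comp_sub_sub_le hs.1 i h hψ.continuous hψ₁)

end TranslationEstimate

/-! ### Total boundedness in `L¹` of the cube -/

section NearDiagonal

section Group

variable {G : Type*} [AddCommGroup G] [MeasurableSpace G] [MeasurableAdd₂ G] {μ : Measure G}
  {U V : Set G} {u : G → ℝ}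

lemma measurableSet_overlap (hU : MeasurableSet U) (h : G) : MeasurableSet (overlap U h) :=
  hU.inter (measurable_add_const h hU)

variable [μ.IsAddLeftInvariant]

lemma translationIncrement_add_le (hU : MeasurableSet U) (hu : Measurable u) {h k : G}
    (hsub : overlap U (h + k) ⊆ overlap U h) :
    translationIncrement μ U u (h + k)
      ≤ translationIncrement μ U u h + translationIncrement μ U u k := by
  have hshift : ∫⁻ x in overlap U (h + k), ‖u (x + h + k) - u (x + h)‖ₑ ∂μ
      ≤ translationIncrement μ U u k := by
    rw [translationIncrement, ← lintegral_indicator (measurableSet_overlap hU _),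
      ← lintegral_indicator (measurableSet_overlap hU _),
      ← lintegral_add_right_eq_self ((overlap U k).indicator _) h]
    have hmem {x : G} (hx : x ∈ overlap U (h + k)) : x + h ∈ overlap U k :=
      ⟨(hsub hx).2, (add_assoc x h k).symm ▸ hx.2⟩
    refine lintegral_mono <| indicator_le fun x hx => ?_
    rw [indicator_of_mem (hmem hx)]
  calc translationIncrement μ U u (h + k)
      ≤ ∫⁻ x in overlap U (h + k), (‖u (x + h) - u x‖ₑ + ‖u (x + h + k) - u (x + h)‖ₑ) ∂μ := by
        refine lintegral_mono fun x => ?_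
        rw [← add_assoc, ← sub_add_sub_cancel', add_comm]
        exact (enorm_add_le _ _).trans_eq (add_comm _ _)
    _ = (∫⁻ x in overlap U (h + k), ‖u (x + h) - u x‖ₑ ∂μ)
          + ∫⁻ x in overlap U (h + k), ‖u (x + h + k) - u (x + h)‖ₑ ∂μ :=
        lintegral_add_left (by fun_prop) _
    _ ≤ _ := add_le_add (lintegral_mono_set hsub) hshift

lemma lintegral_lintegral_sub_mem_eq [MeasurableSub₂ G] [SFinite μ] (hU : MeasurableSet U)
    (hV : MeasurableSet V) (hu : Measurable u) :
    ∫⁻ x in U, ∫⁻ y in {y | y ∈ U ∧ y - x ∈ V}, ‖u y - u x‖ₑ ∂μ ∂μ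
      = ∫⁻ h in V, translationIncrement μ U u h ∂μ := by
  classical
  let W : Set (G × G) := {q | q.2 ∈ V ∧ q.1 ∈ overlap U q.2}
  have hW : MeasurableSet W := (measurable_snd hV).inter <|
    (measurable_fst hU).inter ((measurable_fst.add measurable_snd) hU)
  let F : G → G → ℝ≥0∞ := fun x h => W.indicator (fun q => ‖u (q.1 + q.2) - u q.1‖ₑ) (x, h)
  have hF : Measurable (Function.uncurry F) := Measurable.indicator (by fun_prop) hW
  have hleft (x : G) : U.indicator
      (fun x => ∫⁻ y in {y | y ∈ U ∧ y - x ∈ V}, ‖u y - u x‖ₑ ∂μ) x = ∫⁻ h, F x h ∂μ := by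
    by_cases hx : x ∈ U
    · have hmeas : MeasurableSet {y | y ∈ U ∧ y - x ∈ V} :=
        hU.inter ((measurable_id.sub_const x) hV)
      rw [indicator_of_mem hx, ← lintegral_indicator hmeas, ← lintegral_add_left_eq_self _ x]
      refine lintegral_congr fun h => ?_
      simp [F, W, overlap, indicator_apply, hx, and_comm]
    · simp [F, W, overlap, indicator_apply, hx]
  have hright (h : G) :
      V.indicator (translationIncrement μ U u) h = ∫⁻ x, F x h ∂μ := by
    by_cases hh : h ∈ V
    · rw [indicator_of_mem hh, translationIncrement,
        ← lintegral_indicator (measurableSet_overlap hU h)]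
      simp [F, W, indicator_apply, hh]
    · simp [F, W, indicator_apply, hh]
  rw [← lintegral_indicator hU, ← lintegral_indicator hV, lintegral_congr hleft,
    lintegral_congr hright, lintegral_lintegral_swap hF.aemeasurable]

end Group

lemma overlap_sum_single_insert_subset {ι : Type*} [DecidableEq ι] {V : ι → Set ℝ} {S : Finset ι}
    {a : ι} (ha : a ∉ S) (h : ι → ℝ) :
    overlap (univ.pi V) (∑ i ∈ S, Pi.single i (h i) + Pi.single a (h a))
      ⊆ overlap (univ.pi V) (∑ i ∈ S, Pi.single i (h i)) := by
  refine fun x hx => ⟨hx.1, fun j hj => ?_⟩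
  rcases eq_or_ne j a with rfl | hja
  · have hzero : (∑ i ∈ S, (Pi.single i (h i) : ι → ℝ)) j = 0 := by
      rw [Finset.sum_apply]
      exact Finset.sum_eq_zero fun i hi => Pi.single_eq_of_ne (ne_of_mem_of_not_mem hi ha).symm _
    simpa only [Pi.add_apply, hzero, add_zero] using hx.1 j hj
  · simpa only [Pi.add_apply, Pi.single_eq_of_ne hja, add_zero] using hx.2 j hj

lemma translationIncrement_le_sum_single {ι : Type*} [Fintype ι] [DecidableEq ι] {V : ι → Set ℝ}
    (hV : ∀ i, MeasurableSet (V i)) {u : (ι → ℝ) → ℝ} (hu : Measurable u) (h : ι → ℝ) :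
    translationIncrement volume (univ.pi V) u h
      ≤ ∑ i, translationIncrement volume (univ.pi V) u (Pi.single i (h i)) := by
  have hpartial (S : Finset ι) :
      translationIncrement volume (univ.pi V) u (∑ i ∈ S, Pi.single i (h i))
        ≤ ∑ i ∈ S, translationIncrement volume (univ.pi V) u (Pi.single i (h i)) := by
    induction S using Finset.induction_on with
    | empty => simp [translationIncrement]
    | insert a S ha ih =>
      rw [Finset.sum_insert ha, Finset.sum_insert ha, add_comm, add_comm (translationIncrement ..)]
      exact (translationIncrement_add_le (MeasurableSet.univ_pi hV) hu
        (overlap_sum_single_insert_subset ha h)).trans (add_le_add_left ih _)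
  simpa only [Finset.univ_sum_single] using hpartial Finset.univ

end NearDiagonal

section Average

variable {α : Type*} [MeasurableSpace α] {μ : Measure α}

lemma lintegral_sub_average_le {B : Set α} (hB₀ : μ B ≠ 0) (hB : μ B ≠ ⊤) {u : α → ℝ}
    (hu : IntegrableOn u B μ) :
    ∫⁻ x in B, ‖u x - ⨍ y in B, u y ∂μ‖ₑ ∂μ
      ≤ (μ B)⁻¹ * ∫⁻ x in B, ∫⁻ y in B, ‖u y - u x‖ₑ ∂μ ∂μ := by
  have hreal : μ.real B ≠ 0 := (ENNReal.toReal_pos hB₀ hB).ne'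
  have hpoint (x : α) :
      ‖u x - ⨍ y in B, u y ∂μ‖ₑ ≤ (μ B)⁻¹ * ∫⁻ y in B, ‖u y - u x‖ₑ ∂μ := by
    have haverage : (⨍ y in B, u y ∂μ) - u x = (μ.real B)⁻¹ * ∫ y in B, (u y - u x) ∂μ := by
      rw [integral_sub hu (integrableOn_const hB), setIntegral_const, setAverage_eq]
      simp only [smul_eq_mul]
      field_simp
    rw [enorm_sub_rev, haverage, enorm_mul, enorm_inv hreal,
      Real.enorm_of_nonneg measureReal_nonneg, measureReal_def, ENNReal.ofReal_toReal hB]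
    exact mul_le_mul_right (enorm_integral_le_lintegral_enorm _) _
  refine (lintegral_mono hpoint).trans_eq ?_
  rw [lintegral_const_mul' _ _ (ENNReal.inv_ne_top.2 hB₀)]

lemma sum_lintegral_sub_average_le {ι : Type*} [Fintype ι] {B : ι → Set α}
    (hB : ∀ i, MeasurableSet (B i)) (hdisj : Pairwise (Function.onFun Disjoint B)) {c : ℝ≥0∞}
    (hc₀ : c ≠ 0) (hc : c ≠ ⊤) (hBc : ∀ i, μ (B i) = c) {V : α → Set α}
    (hV : ∀ i, ∀ x ∈ B i, B i ⊆ V x) {u : α → ℝ} (hu : Integrable u μ) :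
    ∑ i, ∫⁻ x in B i, ‖u x - ⨍ y in B i, u y ∂μ‖ₑ ∂μ
      ≤ c⁻¹ * ∫⁻ x, ∫⁻ y in V x, ‖u y - u x‖ₑ ∂μ ∂μ := by
  calc ∑ i, ∫⁻ x in B i, ‖u x - ⨍ y in B i, u y ∂μ‖ₑ ∂μ
      ≤ ∑ i, c⁻¹ * ∫⁻ x in B i, ∫⁻ y in V x, ‖u y - u x‖ₑ ∂μ ∂μ := by
        refine Finset.sum_le_sum fun i _ => ?_
        rw [← hBc i] at hc₀ hc ⊢
        refine (lintegral_sub_average_le hc₀ hc hu.integrableOn).trans (mul_le_mul_right ?_ _)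
        exact setLIntegral_mono' (hB i) fun x hx => lintegral_mono_set (hV i x hx)
    _ = c⁻¹ * ∫⁻ x in ⋃ i, B i, ∫⁻ y in V x, ‖u y - u x‖ₑ ∂μ ∂μ := by
        rw [← Finset.mul_sum, lintegral_iUnion hB hdisj, tsum_fintype]
    _ ≤ _ := mul_le_mul_right (setLIntegral_le_lintegral _ _) _

end Average

section TotallyBounded

lemma totallyBounded_of_edist_le_mul_edist_add {X : Type*} [PseudoMetricSpace X] {S : Set X}
    (h : ∀ ε ≠ (0 : ℝ≥0∞), ∃ (Y : Type*) (_ : PseudoEMetricSpace Y) (T : X → Y) (K : ℝ≥0∞),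
      K ≠ ⊤ ∧ TotallyBounded (T '' S) ∧
        ∀ x ∈ S, ∀ y ∈ S, edist x y ≤ K * edist (T x) (T y) + ε) :
    TotallyBounded S := by
  refine Metric.totallyBounded_iff.2 fun ε hε => ?_
  have hε₂ : ENNReal.ofReal (ε / 2) ≠ 0 := (ENNReal.ofReal_pos.2 (half_pos hε)).ne'
  obtain ⟨Y, _, T, K, hK, hT, hS⟩ := h _ hε₂
  obtain ⟨δ, hδ, hδK⟩ := ENNReal.exists_nnreal_pos_mul_lt hK hε₂
  obtain ⟨t, htS, ht, hcover⟩ := exists_subset_image_finite_and.1 <|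
    EMetric.totallyBounded_iff'.1 hT δ (ENNReal.coe_pos.2 hδ)
  refine ⟨t, ht, fun x hx => ?_⟩
  obtain ⟨_, ⟨y, hy, rfl⟩, hxy⟩ := mem_iUnion₂.1 (hcover (mem_image_of_mem T hx))
  refine mem_iUnion₂.2 ⟨y, hy, edist_lt_ofReal.1 ?_⟩
  calc edist x y ≤ K * edist (T x) (T y) + ENNReal.ofReal (ε / 2) := hS x hx y (htS hy)
    _ ≤ δ * K + ENNReal.ofReal (ε / 2) := by
        rw [mul_comm]
        gcongr
        exact (Metric.mem_eball.1 hxy).le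
    _ < ENNReal.ofReal (ε / 2) + ENNReal.ofReal (ε / 2) :=
        ENNReal.add_lt_add_right ENNReal.ofReal_ne_top hδK
    _ = ENNReal.ofReal ε := by
        rw [← ENNReal.ofReal_add (half_pos hε).le (half_pos hε).le, add_halves]

variable {α : Type*} [MeasurableSpace α] {μ : Measure α}

lemma edist_setIntegral_le {f g : α → ℝ} (hf : Integrable f μ) (hg : Integrable g μ) (B : Set α) :
    edist (∫ x in B, f x ∂μ) (∫ x in B, g x ∂μ) ≤ ∫⁻ x, ‖f x - g x‖ₑ ∂μ := by
  rw [edist_eq_enorm_sub, ← integral_sub hf.integrableOn hg.integrableOn]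
  exact (enorm_integral_le_lintegral_enorm _).trans (setLIntegral_le_lintegral _ _)

lemma setLIntegral_enorm_sub_le [IsFiniteMeasure μ] {f g : α → ℝ}
    (hf : AEStronglyMeasurable f μ) (B : Set α) :
    ∫⁻ x in B, ‖f x - g x‖ₑ ∂μ ≤ edist (∫ x in B, f x ∂μ) (∫ x in B, g x ∂μ)
      + ((∫⁻ x in B, ‖f x - ⨍ y in B, f y ∂μ‖ₑ ∂μ) + ∫⁻ x in B, ‖g x - ⨍ y in B, g y ∂μ‖ₑ ∂μ) := by
  set a := ⨍ y in B, f y ∂μ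
  set b := ⨍ y in B, g y ∂μ
  have hB : μ B ≠ ⊤ := measure_ne_top μ B
  have hconst : ∫⁻ _ in B, ‖a - b‖ₑ ∂μ = edist (∫ x in B, f x ∂μ) (∫ x in B, g x ∂μ) := by
    rw [← measure_smul_setAverage f hB, ← measure_smul_setAverage g hB, edist_eq_enorm_sub,
      ← smul_sub, smul_eq_mul, enorm_mul, Real.enorm_of_nonneg measureReal_nonneg,
      measureReal_def, ENNReal.ofReal_toReal hB, setLIntegral_const, mul_comm]
  have hfa : AEMeasurable (fun x => ‖f x - a‖ₑ) (μ.restrict B) :=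
    (hf.aemeasurable.restrict.sub_const a).enorm
  rw [← hconst, ← lintegral_add_left' hfa, ← lintegral_add_left' aemeasurable_const]
  refine lintegral_mono fun x => ?_
  calc ‖f x - g x‖ₑ = ‖(a - b) + ((f x - a) - (g x - b))‖ₑ := by congr 1; ring
    _ ≤ ‖a - b‖ₑ + (‖f x - a‖ₑ + ‖g x - b‖ₑ) :=
      (enorm_add_le _ _).trans (add_le_add_right enorm_sub_le _)

lemma edist_Lp_one (f g : Lp ℝ 1 μ) : edist f g = ∫⁻ x, ‖f x - g x‖ₑ ∂μ := by
  rw [Lp.edist_def, eLpNorm_one_eq_lintegral_enorm]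
  rfl

lemma lipschitzWith_setIntegral {ι : Type*} [Fintype ι] (B : ι → Set α) :
    LipschitzWith 1 fun (f : Lp ℝ 1 μ) (i : ι) => ∫ x in B i, f x ∂μ := fun f g => by
  rw [ENNReal.coe_one, one_mul, edist_pi_le_iff, edist_Lp_one]
  exact fun i => edist_setIntegral_le (L1.integrable_coeFn f) (L1.integrable_coeFn g) (B i)

theorem totallyBounded_of_sum_lintegral_sub_average_le [IsFiniteMeasure μ] {S : Set (Lp ℝ 1 μ)}
    (hS : Bornology.IsBounded S)
    (h : ∀ ε ≠ (0 : ℝ≥0∞), ∃ (ι : Type*) (_ : Fintype ι) (B : ι → Set α),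
      (∀ᵐ x ∂μ, x ∈ ⋃ i, B i) ∧
        ∀ f ∈ S, ∑ i, ∫⁻ x in B i, ‖f x - ⨍ y in B i, f y ∂μ‖ₑ ∂μ ≤ ε) :
    TotallyBounded S := by
  refine totallyBounded_of_edist_le_mul_edist_add fun ε hε => ?_
  obtain ⟨ι, _, B, hcover, hosc⟩ := h (ε / 2) (ENNReal.half_pos hε).ne'
  refine ⟨ι → ℝ, inferInstance, fun f i => ∫ x in B i, f x ∂μ, Fintype.card ι,
    ENNReal.natCast_ne_top _, ?_, fun f hf g hg => ?_⟩
  · exact ((lipschitzWith_setIntegral B).isBounded_image hS).isCompact_closure.totallyBounded.subset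
      subset_closure
  set T : Lp ℝ 1 μ → ι → ℝ := fun f i => ∫ x in B i, f x ∂μ
  set osc : Lp ℝ 1 μ → ι → ℝ≥0∞ := fun f i => ∫⁻ x in B i, ‖f x - ⨍ y in B i, f y ∂μ‖ₑ ∂μ
  calc edist f g = ∫⁻ x in ⋃ i, B i, ‖f x - g x‖ₑ ∂μ := by
        rw [edist_Lp_one, Measure.restrict_eq_self_of_ae_mem hcover]
    _ ≤ ∑ i, ∫⁻ x in B i, ‖f x - g x‖ₑ ∂μ :=
        (lintegral_iUnion_le B _).trans_eq (tsum_fintype _)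
    _ ≤ ∑ i, (edist (T f) (T g) + (osc f i + osc g i)) := by
        refine Finset.sum_le_sum fun i _ => (setLIntegral_enorm_sub_le
          (Lp.aestronglyMeasurable f) (B i)).trans (add_le_add_left ?_ _)
        exact edist_le_pi_edist (T f) (T g) i
    _ = Fintype.card ι * edist (T f) (T g) + (∑ i, osc f i + ∑ i, osc g i) := by
        simp only [Finset.sum_add_distrib, Finset.sum_const, Finset.card_univ, nsmul_eq_mul]
    _ ≤ Fintype.card ι * edist (T f) (T g) + (ε / 2 + ε / 2) :=
        add_le_add_right (add_le_add (hosc f hf) (hosc g hg)) _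
    _ = Fintype.card ι * edist (T f) (T g) + ε := by rw [ENNReal.add_halves]

end TotallyBounded

section KolmogorovRiesz

open BoxIntegral

/-- The half-open unit cube `(0, 1]ᴺ`, a box with integral vertices that is a.e. equal to `cube N`
and is partitioned exactly by the boxes of a unit partition. -/
def unitBox (N : ℕ) : Box (Fin N) := ⟨0, 1, fun _ => zero_lt_one⟩

lemma hasIntegralVertices_unitBox : hasIntegralVertices (unitBox N) :=
  ⟨0, 1, fun _ => Int.cast_zero.symm, fun _ => Int.cast_one.symm⟩

lemma volume_restrict_cube : volume.restrict (cube N) = volume.restrict (unitBox N) :=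
  Measure.restrict_congr_set <|
    (Box.Ioo_ae_eq_Icc (unitBox N)).trans (Box.coe_ae_eq_Icc (unitBox N)).symm

lemma setLIntegral_sub_mem_ball_le {u : (Fin N → ℝ) → ℝ} (hu : Measurable u) {r : ℝ} {η : ℝ≥0∞}
    (hη : ∀ i, ∀ t : ℝ, |t| < r → translationIncrement volume (cube N) u (Pi.single i t) ≤ η) :
    ∫⁻ x in cube N, ∫⁻ y in {y | y - x ∈ Metric.ball 0 r}, ‖u y - u x‖ₑ ∂volume.restrict (cube N)
      ≤ volume (Metric.ball (0 : Fin N → ℝ) r) * (N * η) := by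
  set V : Set (Fin N → ℝ) := Metric.ball 0 r
  have hincrement (h : Fin N → ℝ) (hh : h ∈ V) : translationIncrement volume (cube N) u h ≤ N * η :=
    calc translationIncrement volume (cube N) u h
        ≤ ∑ i, translationIncrement volume (cube N) u (Pi.single i (h i)) :=
          translationIncrement_le_sum_single (fun _ => measurableSet_Ioo) hu h
      _ ≤ ∑ _i : Fin N, η := Finset.sum_le_sum fun i _ =>
          hη i (h i) ((norm_le_pi_norm h i).trans_lt (mem_ball_zero_iff.1 hh))
      _ = N * η := by simp
  have hV (x : Fin N → ℝ) : MeasurableSet {y | y - x ∈ V} :=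
    (measurable_id.sub_const x) measurableSet_ball
  calc ∫⁻ x in cube N, ∫⁻ y in {y | y - x ∈ V}, ‖u y - u x‖ₑ ∂volume.restrict (cube N)
      = ∫⁻ x in cube N, ∫⁻ y in {y | y ∈ cube N ∧ y - x ∈ V}, ‖u y - u x‖ₑ := by
        refine lintegral_congr fun x => ?_
        rw [Measure.restrict_restrict (hV x), inter_comm]
        rfl
    _ = ∫⁻ h in V, translationIncrement volume (cube N) u h :=
        lintegral_lintegral_sub_mem_eq measurableSet_cube measurableSet_ball hu
    _ ≤ ∫⁻ _ in V, N * η := setLIntegral_mono' measurableSet_ball hincrement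
    _ = volume V * (N * η) := by rw [setLIntegral_const, mul_comm]

variable {n : ℕ} [NeZero n]

lemma unitPartition_box_subset_ball {ν : Fin N → ℤ} {x : Fin N → ℝ}
    (hx : x ∈ unitPartition.box n ν) :
    (unitPartition.box n ν : Set (Fin N → ℝ)) ⊆ {y | y - x ∈ Metric.ball 0 (1 / (n : ℝ))} := by
  intro y hy
  rw [mem_ofPred_eq, mem_ball_zero_iff, pi_norm_lt_iff (by simp [Nat.pos_of_neZero n])]
  intro i
  have hxi := unitPartition.mem_box_iff.1 hx i
  have hyi := unitPartition.mem_box_iff.1 hy i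
  rw [add_div] at hxi hyi
  rw [Pi.sub_apply, Real.norm_eq_abs, abs_lt]
  exact ⟨by linarith [hxi.2, hyi.1], by linarith [hxi.1, hyi.2]⟩

lemma volume_restrict_cube_unitPartition_box {ν : Fin N → ℤ}
    (hν : ν ∈ unitPartition.admissibleIndex n (unitBox N)) :
    volume.restrict (cube N) (unitPartition.box n ν) = 1 / n ^ N := by
  rw [volume_restrict_cube, Measure.restrict_eq_self _
    (Box.coe_subset_coe.2 (unitPartition.mem_admissibleIndex_iff.1 hν)),
    unitPartition.volume_box, Fintype.card_fin]

lemma ae_mem_iUnion_unitPartition_box :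
    ∀ᵐ x ∂volume.restrict (cube N), x ∈ ⋃ ν : unitPartition.admissibleIndex n (unitBox N),
      (unitPartition.box n ν.1 : Set (Fin N → ℝ)) := by
  rw [volume_restrict_cube]
  filter_upwards [ae_restrict_mem (unitBox N).measurableSet_coe] with x hx
  exact mem_iUnion.2 ⟨⟨unitPartition.index n x,
    unitPartition.mem_admissibleIndex_of_mem_box n hasIntegralVertices_unitBox hx⟩,
    unitPartition.mem_box_iff_index.2 rfl⟩

lemma sum_lintegral_sub_average_unitPartition_box_le {u : (Fin N → ℝ) → ℝ} (hu : Measurable u)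
    (hi : IntegrableOn u (cube N)) {η : ℝ≥0∞} (hη : ∀ i, ∀ t : ℝ, |t| < 1 / n →
      translationIncrement volume (cube N) u (Pi.single i t) ≤ η) :
    ∑ ν : unitPartition.admissibleIndex n (unitBox N), ∫⁻ x in unitPartition.box n ν.1,
        ‖u x - ⨍ y in unitPartition.box n ν.1, u y ∂volume.restrict (cube N)‖ₑ
          ∂volume.restrict (cube N)
      ≤ 2 ^ N * (N * η) := by
  set V : Set (Fin N → ℝ) := Metric.ball 0 (1 / n)
  set c : ℝ≥0∞ := 1 / n ^ N with hc
  have hc₀ : c ≠ 0 := by simp [hc]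
  have hc' : c ≠ ⊤ := by simp [hc, NeZero.ne]
  have hvolume : volume V = 2 ^ N * c := by
    have hn : (0 : ℝ) < n := Nat.cast_pos.2 (Nat.pos_of_neZero n)
    rw [Real.volume_pi_ball _ (by positivity), Fintype.card_fin, mul_pow, hc, one_div, one_div,
      ENNReal.ofReal_mul (by positivity), ENNReal.ofReal_pow zero_le_two,
      ENNReal.ofReal_pow (by positivity), ENNReal.ofReal_inv_of_pos hn, ENNReal.ofReal_natCast,
      ENNReal.ofReal_ofNat, ENNReal.inv_pow]
  calc _ ≤ c⁻¹ * ∫⁻ x in cube N, ∫⁻ y in {y | y - x ∈ V}, ‖u y - u x‖ₑ ∂volume.restrict (cube N) :=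
        sum_lintegral_sub_average_le (fun ν => (unitPartition.box n ν.1).measurableSet_coe)
          (fun ν ν' h => unitPartition.disjoint.1 (Subtype.coe_ne_coe.2 h)) hc₀ hc'
          (fun ν => volume_restrict_cube_unitPartition_box ν.2)
          (fun ν x hx => unitPartition_box_subset_ball hx) hi
    _ ≤ c⁻¹ * (2 ^ N * c * (N * η)) := by
        rw [← hvolume]
        exact mul_le_mul_right (setLIntegral_sub_mem_ball_le hu hη) _
    _ = 2 ^ N * (N * η) := by
        rw [mul_comm (2 ^ N) c, mul_assoc, ← mul_assoc, ENNReal.inv_mul_cancel hc₀ hc', one_mul]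

theorem totallyBounded_of_translationIncrement_le {S : Set (Lp ℝ 1 (volume.restrict (cube N)))}
    (hS : Bornology.IsBounded S)
    (h : ∀ ε ≠ (0 : ℝ≥0∞), ∀ᶠ t in 𝓝 (0 : ℝ), ∀ f ∈ S, ∀ i,
      translationIncrement volume (cube N) f (Pi.single i t) ≤ ε) :
    TotallyBounded S := by
  have : IsFiniteMeasure (volume.restrict (cube N)) :=
    isFiniteMeasure_restrict.2 <|
      measure_ne_top_of_subset cube_subset_Icc isCompact_Icc.measure_ne_top
  refine totallyBounded_of_sum_lintegral_sub_average_le hS fun ε hε => ?_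
  obtain ⟨η, hη, hηε⟩ := ENNReal.exists_nnreal_pos_mul_lt (a := 2 ^ N * N)
    (ENNReal.mul_ne_top (ENNReal.pow_ne_top ENNReal.ofNat_ne_top) (ENNReal.natCast_ne_top N)) hε
  obtain ⟨ρ, hρ, hincrement⟩ := Metric.eventually_nhds_iff.1 (h η (ENNReal.coe_ne_zero.2 hη.ne'))
  obtain ⟨m, hm⟩ := exists_nat_one_div_lt hρ
  refine ⟨unitPartition.admissibleIndex (m + 1) (unitBox N), inferInstance,
    fun ν => unitPartition.box (m + 1) ν.1, ae_mem_iUnion_unitPartition_box, fun f hf => ?_⟩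
  refine (sum_lintegral_sub_average_unitPartition_box_le (Lp.stronglyMeasurable f).measurable
    (L1.integrable_coeFn f) fun i t ht => hincrement (y := t) ?_ f hf i).trans ?_
  · rw [dist_zero_right, Real.norm_eq_abs]
    exact ht.trans (mod_cast hm)
  · rw [← mul_assoc, mul_comm]
    exact hηε.le

end KolmogorovRiesz

/-! ### Compactness of bounded sets of `BV^s` -/

section ExponentComparison

lemma rlPartialRight_const_mul (s c : ℝ) (i : Fin N) (w : (Fin N → ℝ) → ℝ) (x : Fin N → ℝ) :
    rlPartialRight s i (fun y => c * w y) x = c * rlPartialRight s i w x := by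
  simp only [rlPartialRight, rlDerivRight, mul_div_assoc, intervalIntegral.integral_const_mul,
    deriv_const_mul_field]
  ring

lemma fracDiv_const_smul (s c : ℝ) (φ : (Fin N → ℝ) → (Fin N → ℝ)) (x : Fin N → ℝ) :
    fracDiv s (fun y => c • φ y) x = c * fracDiv s φ x := by
  simp only [fracDiv, Pi.smul_apply, smul_eq_mul, rlPartialRight_const_mul, ← Finset.mul_sum]
  ring

variable {p q : ℝ≥0∞}

lemma sum_mul_le_sum_abs (hp : 1 ≤ p) {x : Fin N → ℝ} (hx : ‖WithLp.toLp p x‖ ≤ 1)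
    (y : Fin N → ℝ) : ∑ i, x i * y i ≤ ∑ i, |y i| := by
  have : Fact (1 ≤ p) := ⟨hp⟩
  refine Finset.sum_le_sum fun i _ => (le_abs_self _).trans ?_
  rw [abs_mul]
  exact mul_le_of_le_one_left (abs_nonneg _) ((PiLp.norm_apply_le (WithLp.toLp p x) i).trans hx)

lemma dualNorm_le_sum_abs (hp : 1 ≤ p) (y : Fin N → ℝ) : dualNorm p y ≤ ∑ i, |y i| := by
  refine Real.sSup_le ?_ (Finset.sum_nonneg fun _ _ => abs_nonneg _)
  rintro _ ⟨x, hx, rfl⟩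
  exact sum_mul_le_sum_abs hp hx y

lemma abs_apply_le_dualNorm (hp : 1 ≤ p) (y : Fin N → ℝ) (i : Fin N) : |y i| ≤ dualNorm p y := by
  have : Fact (1 ≤ p) := ⟨hp⟩
  have hsign (σ : ℝ) (hσ : |σ| ≤ 1) : σ * y i ≤ dualNorm p y := by
    refine le_csSup ⟨∑ j, |y j|, ?_⟩ ⟨Pi.single i σ, ?_, ?_⟩
    · rintro _ ⟨x, hx, rfl⟩
      exact sum_mul_le_sum_abs hp hx y
    · exact (PiLp.norm_single p (fun _ : Fin N => ℝ) i σ).trans_le hσ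
    · simp [Pi.single_apply]
  refine abs_le'.2 ⟨?_, ?_⟩
  · simpa using hsign 1 (by simp)
  · simpa using hsign (-1) (by simp)

lemma dualNorm_inv_smul_le (hN : 1 ≤ N) (hp : 1 ≤ p) (hq : 1 ≤ q) (y : Fin N → ℝ) :
    dualNorm q ((N : ℝ)⁻¹ • y) ≤ dualNorm p y := by
  have hN' : (N : ℝ) ≠ 0 := Nat.cast_ne_zero.2 (Nat.one_le_iff_ne_zero.1 hN)
  calc dualNorm q ((N : ℝ)⁻¹ • y) ≤ ∑ i, |((N : ℝ)⁻¹ • y) i| := dualNorm_le_sum_abs hq _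
    _ = ∑ i, (N : ℝ)⁻¹ * |y i| := by simp [abs_mul]
    _ ≤ ∑ _i : Fin N, (N : ℝ)⁻¹ * dualNorm p y := Finset.sum_le_sum fun i _ =>
        mul_le_mul_of_nonneg_left (abs_apply_le_dualNorm hp y i) (by positivity)
    _ = dualNorm p y := by simp [hN']

lemma IsTestField.inv_smul (hN : 1 ≤ N) (hp : 1 ≤ p) (hq : 1 ≤ q)
    {φ : (Fin N → ℝ) → (Fin N → ℝ)} (hφ : IsTestField p φ) :
    IsTestField q fun x => (N : ℝ)⁻¹ • φ x where
  smooth := hφ.smooth.const_smul (N : ℝ)⁻¹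
  compactSupport := hφ.compactSupport.smul_left (f := fun _ => (N : ℝ)⁻¹)
  support_subset := (tsupport_smul_subset_right (fun _ => (N : ℝ)⁻¹) φ).trans hφ.support_subset
  dualNorm_le x := (dualNorm_inv_smul_le hN hp hq _).trans (hφ.dualNorm_le x)

lemma fracTV_le_mul (hN : 1 ≤ N) (hp : 1 ≤ p) (hq : 1 ≤ q) (s : ℝ) (u : (Fin N → ℝ) → ℝ) :
    fracTV s q u ≤ N * fracTV s p u := by
  have hN' : (N : ℝ) ≠ 0 := Nat.cast_ne_zero.2 (Nat.one_le_iff_ne_zero.1 hN)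
  refine iSup₂_le fun φ hφ => ?_
  have hscale : ∫ x in cube N, u x * fracDiv s φ x
      = N * ∫ x in cube N, u x * fracDiv s (fun y => (N : ℝ)⁻¹ • φ y) x := by
    simp only [fracDiv_const_smul, mul_left_comm (u _), integral_const_mul]
    rw [mul_inv_cancel_left₀ hN']
  rw [hscale, ENNReal.ofReal_mul N.cast_nonneg, ENNReal.ofReal_natCast]
  exact mul_le_mul_right (le_iSup₂ (f := fun φ (_ : IsTestField p φ) =>
    ENNReal.ofReal (∫ x in cube N, u x * fracDiv s φ x)) _ (hφ.inv_smul hN hq hp)) _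

end ExponentComparison

section Compactness

variable {s : ℝ} {p : ℝ≥0∞}

lemma exists_continuous_eqOn_fracDiv (hs : s < 1) {φ : (Fin N → ℝ) → (Fin N → ℝ)}
    (hφ : IsTestField p φ) : ∃ D, Continuous D ∧ EqOn (fracDiv s φ) D (cube N) := by
  have hφi (i : Fin N) : ContDiff ℝ 1 fun y => φ y i :=
    (contDiff_pi.1 hφ.smooth i).of_le (by simp)
  refine ⟨fun x => divConst N s * ∑ i, -(1 / Real.Gamma (1 - s)) *
    partialFracIntegral (1 - s) i (partialDeriv i fun y => φ y i) x, ?_, fun x hx => ?_⟩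
  · exact continuous_const.mul <| continuous_finsetSum _ fun i _ => continuous_const.mul <|
      continuous_partialFracIntegral (sub_pos.2 hs) i (continuous_partialDeriv (hφi i) i)
  · have hzero (i : Fin N) (y : Fin N → ℝ) (hy : 1 ≤ y i) : φ y i = 0 :=
      congrFun (eq_zero_of_tsupport_subset_cube hφ.support_subset hy) i
    rw [fracDiv, divConst]
    congr 1
    exact Finset.sum_congr rfl fun i _ =>
      rlPartialRight_eq hs i (hφi i) (hzero i) (hx i (mem_univ i))

lemma tendsto_setIntegral_mul_of_tendsto_normL1 {ι : Type*} {l : Filter ι}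
    {u : ι → (Fin N → ℝ) → ℝ} {v D : (Fin N → ℝ) → ℝ} (hu : ∀ n, IntegrableOn (u n) (cube N))
    (hv : IntegrableOn v (cube N)) (hD : Continuous D)
    (h : Tendsto (fun n => normL1 fun x => u n x - v x) l (𝓝 0)) :
    Tendsto (fun n => ∫ x in cube N, u n x * D x) l (𝓝 (∫ x in cube N, v x * D x)) := by
  obtain ⟨E, hE⟩ := (isCompact_Icc (a := (0 : Fin N → ℝ)) (b := 1)).exists_bound_of_continuousOn
    hD.continuousOn
  have hlimit : Tendsto (fun n => E * (normL1 fun x => u n x - v x).toReal) l (𝓝 0) := by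
    simpa using ((ENNReal.tendsto_toReal ENNReal.zero_ne_top).comp h).const_mul E
  rw [tendsto_iff_norm_sub_tendsto_zero]
  refine squeeze_zero (fun _ => norm_nonneg _) (fun n => ?_) hlimit
  rw [← integral_sub (integrableOn_mul_of_continuous (hu n) hD)
    (integrableOn_mul_of_continuous hv hD)]
  simp only [← sub_mul]
  exact abs_integral_mul_le_mul_normL1 ((hu n).sub hv) fun x hx => hE x (cube_subset_Icc hx)

lemma fracTV_le_of_tendsto (hs : s < 1) {ι : Type*} {l : Filter ι} [l.NeBot]
    {u : ι → (Fin N → ℝ) → ℝ} {v : (Fin N → ℝ) → ℝ} (hu : ∀ n, IntegrableOn (u n) (cube N))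
    (hv : IntegrableOn v (cube N)) (h : Tendsto (fun n => normL1 fun x => u n x - v x) l (𝓝 0))
    {M : ℝ≥0∞} (hM : ∀ n, fracTV s p (u n) ≤ M) : fracTV s p v ≤ M := by
  refine iSup₂_le fun φ hφ => ?_
  obtain ⟨D, hD, hφD⟩ := exists_continuous_eqOn_fracDiv hs hφ
  have hrepresent (w : (Fin N → ℝ) → ℝ) :
      ∫ x in cube N, w x * fracDiv s φ x = ∫ x in cube N, w x * D x :=
    setIntegral_congr_fun measurableSet_cube fun x hx => congrArg (w x * ·) (hφD hx)
  rw [hrepresent]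
  refine le_of_tendsto' ((ENNReal.continuous_ofReal.tendsto _).comp
    (tendsto_setIntegral_mul_of_tendsto_normL1 hu hv hD h)) fun n => ?_
  rw [Function.comp_apply, ← hrepresent]
  exact (le_iSup₂ (f := fun φ (_ : IsTestField p φ) =>
    ENNReal.ofReal (∫ x in cube N, u n x * fracDiv s φ x)) φ hφ).trans (hM n)

lemma fracBVNorm_congr_ae {u v : (Fin N → ℝ) → ℝ} (h : u =ᵐ[volume.restrict (cube N)] v) :
    fracBVNorm s p u = fracBVNorm s p v := by
  have hTV : fracTV s p u = fracTV s p v := by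
    refine iSup_congr fun φ => iSup_congr fun _ => congrArg ENNReal.ofReal (integral_congr_ae ?_)
    filter_upwards [h] with x hx
    rw [hx]
  rw [fracBVNorm, fracBVNorm, hTV, normL1, normL1, eLpNorm_congr_ae h]

theorem totallyBounded_setOf_fracBVNorm_le (hN : 1 ≤ N) (hs : s ∈ Ioo (0 : ℝ) 1) (hp : 1 ≤ p)
    {M : ℝ≥0∞} (hM : M ≠ ⊤) :
    TotallyBounded {f : Lp ℝ 1 (volume.restrict (cube N)) | fracBVNorm s p f ≤ M} := by
  obtain ⟨A, hA, htranslation⟩ := exists_translationIncrement_single_le hN hs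
  refine totallyBounded_of_translationIncrement_le ?_ fun ε hε => ?_
  · refine Metric.isBounded_iff_subset_closedBall 0 |>.2 ⟨M.toReal, fun f hf => ?_⟩
    rw [mem_closedBall_zero_iff, Lp.norm_def]
    exact ENNReal.toReal_mono hM (le_self_add.trans hf)
  · have hlimit : Tendsto (fun t => ENNReal.ofReal (A * kernelModulus s t * M.toReal))
        (𝓝 0) (𝓝 0) := by
      simpa using ENNReal.tendsto_ofReal
        (((tendsto_kernelModulus hs.1).const_mul A).mul_const M.toReal)
    filter_upwards [hlimit.eventually_lt_const (pos_iff_ne_zero.2 hε)] with t ht f hf i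
    have hTV : fracTV s p f < ⊤ := (le_add_self.trans hf).trans_lt hM.lt_top
    refine (htranslation hp (L1.integrable_coeFn f) hTV i t).trans (le_trans ?_ ht.le)
    gcongr
    exact mul_nonneg hA (integral_nonneg fun _ => norm_nonneg _)

theorem exists_subseq_tendsto_normL1 (hN : 1 ≤ N) (hs : s ∈ Ioo (0 : ℝ) 1) (hp : 1 ≤ p)
    {u : ℕ → (Fin N → ℝ) → ℝ} (hu : ∀ n, IntegrableOn (u n) (cube N)) {M : ℝ≥0∞} (hM : M ≠ ⊤)
    (hbound : ∀ n, fracBVNorm s p (u n) ≤ M) :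
    ∃ v : (Fin N → ℝ) → ℝ, IntegrableOn v (cube N) ∧ ∃ k : ℕ → ℕ, StrictMono k ∧
      Tendsto (fun n => normL1 fun x => u (k n) x - v x) atTop (𝓝 0) := by
  have hcompact : IsCompact (closure {f : Lp ℝ 1 (volume.restrict (cube N)) |
      fracBVNorm s p f ≤ M}) :=
    (totallyBounded_setOf_fracBVNorm_le hN hs hp hM).closure.isCompact_of_isClosed isClosed_closure
  obtain ⟨v, -, k, hk, hlimit⟩ := hcompact.tendsto_subseq fun n => subset_closure <|
    (fracBVNorm_congr_ae (hu n).coeFn_toL1).trans_le (hbound n)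
  refine ⟨v, L1.integrable_coeFn v, k, hk, (tendsto_iff_edist_tendsto_0.1 hlimit).congr fun n => ?_⟩
  rw [Function.comp_apply, Lp.edist_def, normL1]
  exact eLpNorm_congr_ae ((hu (k n)).coeFn_toL1.sub (ae_eq_refl v))

end Compactness

end FracBV

end

open FracBV in
theorem theorem4p2_general (N : ℕ) (hN : 1 ≤ N) (s : ℝ) (hs : s ∈ Set.Ioo (0 : ℝ) 1)
    (p : ℝ≥0∞) (hp : 1 ≤ p) (u : ℕ → (Fin N → ℝ) → ℝ) (hu : ∀ n, IntegrableOn (u n) (cube N))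
    (hbound : (⨆ n, fracBVNorm s p (u n)) < ⊤) :
    ∃ v : (Fin N → ℝ) → ℝ, MemFracBV s v ∧
      ∃ k : ℕ → ℕ, StrictMono k ∧
        Tendsto (fun n => normL1 (fun x => u (k n) x - v x)) atTop (𝓝 0) := by
  have hle (n : ℕ) : fracBVNorm s p (u n) ≤ ⨆ n, fracBVNorm s p (u n) :=
    le_iSup (fun n => fracBVNorm s p (u n)) n
  obtain ⟨v, hv, k, hk, hlimit⟩ := exists_subseq_tendsto_normL1 hN hs hp hu hbound.ne hle
  have hTV : fracTV s p v < ⊤ := (fracTV_le_of_tendsto hs.2 (fun n => hu (k n)) hv hlimit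
    fun n => le_add_self.trans (hle (k n))).trans_lt hbound
  exact ⟨v, ⟨hv, fun q hq => (fracTV_le_mul hN hp hq s v).trans_lt
    (ENNReal.mul_lt_top (ENNReal.natCast_lt_top N) hTV)⟩, k, hk, hlimit⟩

theorem theorem4p2 (N : ℕ) (hN : 1 ≤ N) (s : ℝ) (hs : s ∈ Set.Ioo (0 : ℝ) 1)
    (p : ℝ≥0∞) (hp : 1 ≤ p) (u : ℕ → (Fin N → ℝ) → ℝ)
    (hSV : ∀ n, FracBV.MemSV s (u n)) (hBV : ∀ n, FracBV.MemBV (u n))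
    (hbound : (⨆ n, (FracBV.boundaryNorm (u n) + FracBV.fracBVNorm s p (u n))) < ⊤) :
    ∃ v : (Fin N → ℝ) → ℝ, FracBV.MemFracBV s v ∧
      ∃ k : ℕ → ℕ, StrictMono k ∧
        Tendsto (fun n => FracBV.normL1 (fun x => u (k n) x - v x)) atTop (𝓝 0) :=
  theorem4p2_general N hN s hs p hp u (fun n => (hBV n).1) <|
    (iSup_mono fun _ => le_add_self).trans_lt hbound
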